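/- Let $\Omega\subset\mathbb{R}^3$ be a bounded Lipschitz domain, $T\in(0,\infty]$, and let $\eta,\mu,\gamma>0$ be constants. Write $A:B=\sum_{j,k}A_{jk}B_{jk}$, $(\nabla v)_{jk}=\partial_k v_j$, $D(v)=\tfrac12(\nabla v+\nabla v^\top)$, $W(v)=\tfrac12(\nabla v-\nabla v^\top)$, and $\|\cdot\|_2$ for the norm of $L^2(\Omega)$. Let $L^2_\sigma(\Omega)$ be the space of $v\in L^2(\Omega)^3$ with $\operatorname{div}v=0$ in $\Omega$ and $v\cdot n=0$ on $\partial\Omega$ in the weak sense, and $L^2_\delta(\Omega)=\{S\in L^2(\Omega)^{3\times3}: S=S^\top,\ \operatorname{tr}S=0\}$. For $0<T'<T$ put $$\mathrm{LH}_{T'}=L^\infty(0,T';L^2_\sigma(\Omega))\cap L^2(0,T';H^1(\Omega)^3),\qquad \mathrm{X}_{T'}=L^\infty(0,T';L^2_\delta(\Omega))\cap L^2(0,T';H^1(\Omega)^{3\times3}),$$ $$Z_{T'}=H^1(0,T';L^2_\delta(\Omega))\cap L^2(0,T';H^1(\Omega)^{3\times3})\cap L^5(0,T';L^5(\Omega)^{3\times3}).$$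 Let $\mathcal P:L^2_\delta(\Omega)\to[0,\infty]$ be convex and lower semicontinuous with $\mathcal P(0)=0$. Let $V_0\in L^2_\sigma(\Omega)$, $S_0\in L^2_\delta(\Omega)$, $F_0\in L^1_{\mathrm{loc}}([0,T);L^2(\Omega)^3)$, $F_1\in L^2_{\mathrm{loc}}([0,T);L^2(\Omega)^{3\times3})$, and let $g$ be boundary data with $g(t)\in L^2(\partial\Omega)^3$. A pair $(V,S)$ is called a generalized solution if $(V,S)\in\mathrm{LH}_{T'}\times\mathrm{X}_{T'}$ for all $T'\in(0,T)$; $V(t)$ has the boundary trace $g(t)$ for almost every $t\in(0,T)$; $$\int_0^T\!\!\int_\Omega\big(-V\cdot\partial_t\Phi-V\otimes V:\nabla\Phi+\eta S:\nabla\Phi+\mu\nabla V:\nabla\Phi\big)\,dx\,dt=\int_0^T\!\!\int_\Omega\big(F_0\cdot\Phi-F_1:\nabla\Phi\big)\,dx\,dt+\int_\Omega V_0\cdot\Phi(\cdot,0)\,dx$$ for all divergence-free $\Phi\in C^\infty_0(\Omega\times[0,T))^3$; and, for all $T'\in(0,T)$ and all $\tilde S\in Z_{T'}$, $$\int_0^{T'}\!\!\int_\Omega\big(\partial_t\tilde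 S:(\tilde S-S)+\gamma\nabla S:\nabla(\tilde S-S)\big)\,dx\,dt+\int_0^{T'}\!\big(\mathcal P(\tilde S)-\mathcal P(S)\big)\,dt$$ $$+\int_0^{T'}\!\!\int_\Omega\big(V\cdot\nabla S:\tilde S+(S\,W(V)-W(V)\,S):\tilde S-\eta D(V):(\tilde S-S)\big)\,dx\,dt\ \ge\ -\tfrac12\|\tilde S(0)-S_0\|_2^2 .$$ Here the inequality is understood as an upper bound for $\int_0^{T'}\mathcal P(S)\,dt$ in $[0,\infty]$, with this term moved to the other side. Then every generalized solution $(V,S)$ satisfies, for almost every $T'\in(0,T)$, $$\tfrac12\|S(T')\|_2^2+\gamma\|\nabla S\|_{L^2(\Omega\times(0,T'))}^2+\int_0^{T'}\mathcal P(S)\,d\tau\ \le\ \tfrac12\|S_0\|_2^2+\int_0^{T'}\!\!\int_\Omega\eta\,D(V):S\,dx\,d\tau .$$ -/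

import Mathlib

open MeasureTheory Set Filter Topology
open scoped ContDiff

namespace ViscoFluid

/-! ### Pointwise tensor algebra -/

/-- Vectors of `ℝ³` with the Euclidean inner product. -/
abbrev Vec : Type := EuclideanSpace ℝ (Fin 3)

/-- Tensors of `ℝ^{3×3}`; the inner product is `A : B = ∑ A_{jk} B_{jk}`. -/
abbrev Ten : Type := EuclideanSpace ℝ (Fin 3 × Fin 3)

/-- The symmetric part `(M + Mᵀ)/2`. -/
noncomputable def symPart (M : Ten) : Ten :=
  WithLp.toLp 2 fun p => (M (p.1, p.2) + M (p.2, p.1)) / 2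

/-- The antisymmetric part `(M - Mᵀ)/2`. -/
noncomputable def skewPart (M : Ten) : Ten :=
  WithLp.toLp 2 fun p => (M (p.1, p.2) - M (p.2, p.1)) / 2

/-- The matrix commutator `S W - W S`. -/
noncomputable def tensorCommutator (S W : Ten) : Ten :=
  WithLp.toLp 2 fun p => ∑ j, (S (p.1, j) * W (j, p.2) - W (p.1, j) * S (j, p.2))

/-- The tensor product `(a ⊗ b)_{jk} = a_j b_k`. -/
noncomputable def tensorProd (a b : Vec) : Ten :=
  WithLp.toLp 2 fun p => a p.1 * b p.2

/-- The directional derivative `(v · ∇S)_{kl} = ∑ v_j ∂_j S_{kl}`, where `G` is the gradient of `S`,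
that is `G ((k, l), j) = ∂_j S_{kl}`. -/
noncomputable def convect (v : Vec) (G : EuclideanSpace ℝ ((Fin 3 × Fin 3) × Fin 3)) : Ten :=
  WithLp.toLp 2 fun p => ∑ j, v j * G (p, j)

/-! ### Bounded Lipschitz domains -/

/-- `Ω` is a bounded Lipschitz domain: a bounded, open, connected (hence nonempty) set that near
each of its boundary points is, in suitable Cartesian coordinates, the strict epigraph of a
Lipschitz function of two variables. -/
structure IsBoundedLipschitzDomain (Ω : Set Vec) : Prop where
  isOpen : IsOpen Ω
  isConnected : IsConnected Ω
  isBounded : Bornology.IsBounded Ω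
  exists_chart : ∀ x ∈ frontier Ω,
    ∃ (e : Vec ≃ₗᵢ[ℝ] Vec) (ψ : EuclideanSpace ℝ (Fin 2) → ℝ) (K : NNReal) (U : Set Vec),
      LipschitzWith K ψ ∧ IsOpen U ∧ x ∈ U ∧
        ∀ y ∈ U, (y ∈ Ω ↔ ψ !₂[e y 0, e y 1] < e y 2)

/-! ### Lebesgue and Sobolev spaces on `Ω` -/

/-- `L²(Ω)` for fields with values in `ℝ^ι`. -/
abbrev L2 (Ω : Set Vec) (ι : Type) [Fintype ι] : Type :=
  Lp (EuclideanSpace ℝ ι) 2 (volume.restrict Ω)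

/-- The classical gradient `(∇f)_{(i, j)} = ∂_j f_i`. -/
noncomputable def grad {ι : Type} [Fintype ι] (f : Vec → EuclideanSpace ℝ ι) (x : Vec) :
    EuclideanSpace ℝ (ι × Fin 3) :=
  WithLp.toLp 2 fun p => fderiv ℝ f x (EuclideanSpace.single p.2 1) p.1

/-- `G` is the weak gradient of `u` in `Ω`: `G_{(i, j)} = ∂_j u_i` in the sense of distributions. -/
def IsWeakGrad {Ω : Set Vec} {ι : Type} [Fintype ι] (u : L2 Ω ι) (G : L2 Ω (ι × Fin 3)) : Prop :=
  ∀ φ : Vec → ℝ, ContDiff ℝ ∞ φ → HasCompactSupport φ → tsupport φ ⊆ Ω → ∀ (i : ι) (j : Fin 3),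
    ∫ x in Ω, u x i * fderiv ℝ φ x (EuclideanSpace.single j 1) = - ∫ x in Ω, G x (i, j) * φ x

/-- `u ∈ H¹(Ω)`. -/
def MemH1 {Ω : Set Vec} {ι : Type} [Fintype ι] (u : L2 Ω ι) : Prop :=
  ∃ G : L2 Ω (ι × Fin 3), IsWeakGrad u G

open Classical in
/-- The weak gradient of `u ∈ H¹(Ω)` (and `0` for other `u`). -/
noncomputable def weakGrad {Ω : Set Vec} {ι : Type} [Fintype ι] (u : L2 Ω ι) : L2 Ω (ι × Fin 3) :=
  if h : MemH1 u then h.choose else 0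

/-- `v ∈ L²_σ(Ω)`: weakly, `div v = 0` in `Ω` and `v · n = 0` on `∂Ω`. The test functions range over
the restrictions to the closure of `Ω` of smooth functions. -/
def IsSolenoidal {Ω : Set Vec} (v : L2 Ω (Fin 3)) : Prop :=
  ∀ φ : Vec → ℝ, ContDiff ℝ ∞ φ → HasCompactSupport φ → ∫ x in Ω, fderiv ℝ φ x (v x) = 0

/-- `L²_δ(Ω)`: the square-integrable fields of symmetric, trace-free tensors. -/
noncomputable def L2dev (Ω : Set Vec) : Submodule ℝ (L2 Ω (Fin 3 × Fin 3)) where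
  carrier := {S | ∀ᵐ x ∂(volume.restrict Ω),
    (∀ i j, S x (i, j) = S x (j, i)) ∧ ∑ i, S x (i, i) = 0}
  add_mem' := by
    intro A B hA hB
    filter_upwards [hA, hB, Lp.coeFn_add A B] with x hxA hxB hx
    refine ⟨fun i j => ?_, ?_⟩
    · rw [hx]; simp [hxA.1 i j, hxB.1 i j]
    · rw [hx]; simp [Finset.sum_add_distrib, hxA.2, hxB.2]
  zero_mem' := by
    filter_upwards [Lp.coeFn_zero (EuclideanSpace ℝ (Fin 3 × Fin 3)) 2 (volume.restrict Ω)]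
      with x hx
    rw [hx]; simp
  smul_mem' := by
    intro c A hA
    filter_upwards [hA, Lp.coeFn_smul c A] with x hxA hx
    refine ⟨fun i j => ?_, ?_⟩
    · rw [hx]; simp [hxA.1 i j]
    · rw [hx]; simp [← Finset.mul_sum, hxA.2]

/-- The surface measure on `∂Ω`, up to a constant factor. -/
noncomputable def surfaceMeasure (Ω : Set Vec) : Measure Vec :=
  (Measure.hausdorffMeasure 2).restrict (frontier Ω)

/-- `h` is the boundary trace of `u ∈ H¹(Ω)³`: there are smooth functions on the closure of `Ω`
which converge to `u` in `H¹(Ω)` and whose boundary values converge to `h` in `L²(∂Ω)`. -/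
def HasTrace {Ω : Set Vec} (u : L2 Ω (Fin 3)) (h : Lp Vec 2 (surfaceMeasure Ω)) : Prop :=
  MemH1 u ∧ ∃ φ : ℕ → Vec → Vec, (∀ n, ContDiff ℝ ∞ (φ n) ∧ HasCompactSupport (φ n)) ∧
    Tendsto (fun n => eLpNorm (fun x => φ n x - u x) 2 (volume.restrict Ω)) atTop (𝓝 0) ∧
    Tendsto (fun n => eLpNorm (fun x => grad (φ n) x - weakGrad u x) 2 (volume.restrict Ω))
      atTop (𝓝 0) ∧
    Tendsto (fun n => eLpNorm (fun y => φ n y - h y) 2 (surfaceMeasure Ω)) atTop (𝓝 0)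

/-! ### Spaces of time-dependent functions -/

/-- The time interval `(0, T)`, where `T` may be infinite. -/
def timeInterval (T : EReal) : Set ℝ := {t | 0 < t ∧ (t : EReal) < T}

/-- `u ∈ L²(0, T'; H¹(Ω))`, for a given `u : (0, T') → L²(Ω)`; it is added to a condition that makes
`u` an element of `L²(0, T'; L²(Ω))`. -/
def MemL2H1 {Ω : Set Vec} {ι : Type} [Fintype ι] (T' : ℝ) (u : ℝ → L2 Ω ι) : Prop :=
  (∀ᵐ t ∂(volume.restrict (Ioo 0 T')), MemH1 (u t)) ∧
    MemLp (fun t => weakGrad (u t)) 2 (volume.restrict (Ioo 0 T'))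

/-- The Leray--Hopf class `LH_{T'} = L^∞(0, T'; L²_σ(Ω)) ∩ L²(0, T'; H¹(Ω)³)`. -/
structure MemLH {Ω : Set Vec} (T' : ℝ) (V : ℝ → L2 Ω (Fin 3)) : Prop where
  memLp : MemLp V ⊤ (volume.restrict (Ioo 0 T'))
  solenoidal : ∀ᵐ t ∂(volume.restrict (Ioo 0 T')), IsSolenoidal (V t)
  memL2H1 : MemL2H1 T' V

/-- The class `X_{T'} = L^∞(0, T'; L²_δ(Ω)) ∩ L²(0, T'; H¹(Ω)^{3×3})`. -/
structure MemX {Ω : Set Vec} (T' : ℝ) (S : ℝ → L2dev Ω) : Prop where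
  memLp : MemLp S ⊤ (volume.restrict (Ioo 0 T'))
  memL2H1 : MemL2H1 T' (fun t => (S t : L2 Ω (Fin 3 × Fin 3)))

/-- `R` is the function in the class
`Z_{T'} = H¹(0, T'; L²_δ(Ω)) ∩ L²(0, T'; H¹(Ω)^{3×3}) ∩ L⁵(0, T'; L⁵(Ω)^{3×3})`
with the weak time derivative `dR`. An element of `H¹(0, T'; L²_δ(Ω))` is identified with its unique
representative that is continuous on `[0, T']`, so that `R 0` is its initial value. -/
structure MemZ {Ω : Set Vec} (T' : ℝ) (R dR : ℝ → L2dev Ω) : Prop where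
  continuousOn : ContinuousOn R (Icc 0 T')
  memLp_deriv : MemLp dR 2 (volume.restrict (Ioo 0 T'))
  weakDeriv : ∀ θ : ℝ → ℝ, ContDiff ℝ ∞ θ → HasCompactSupport θ → tsupport θ ⊆ Ioo 0 T' →
    ∫ t in Ioo 0 T', deriv θ t • (R t : L2 Ω (Fin 3 × Fin 3)) =
      - ∫ t in Ioo 0 T', θ t • (dR t : L2 Ω (Fin 3 × Fin 3))
  memL2H1 : MemL2H1 T' (fun t => (R t : L2 Ω (Fin 3 × Fin 3)))
  memL5 : ∫⁻ t in Ioo 0 T', ∫⁻ x in Ω, ‖(R t : L2 Ω (Fin 3 × Fin 3)) x‖ₑ ^ 5 < ⊤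

/-- `Φ` is in `C^∞_{0,σ}(Ω × [0, T))`: the restriction to times `t ≥ 0` of a smooth function with
compact support in `Ω × (-∞, T)`, solenoidal at all times `t ≥ 0`. -/
structure IsTestVelocity (Ω : Set Vec) (T : EReal) (Φ : ℝ → Vec → Vec) : Prop where
  contDiff : ContDiff ℝ ∞ (fun p : ℝ × Vec => Φ p.1 p.2)
  hasCompactSupport : HasCompactSupport (fun p : ℝ × Vec => Φ p.1 p.2)
  tsupport_subset : tsupport (fun p : ℝ × Vec => Φ p.1 p.2) ⊆ {p | (p.1 : EReal) < T ∧ p.2 ∈ Ω}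
  div_eq_zero : ∀ t, 0 ≤ t → ∀ x, ∑ i, grad (Φ t) x (i, i) = 0

/-! ### The fluid model -/

/-- Dissipation potentials: `P : L²_δ(Ω) → [0, ∞]` is convex and lower semicontinuous with
`P(0) = 0`. -/
structure IsPotential {Ω : Set Vec} (P : L2dev Ω → ENNReal) : Prop where
  convex : ∀ (A B : L2dev Ω) (θ : ℝ), 0 ≤ θ → θ ≤ 1 →
    P (θ • A + (1 - θ) • B) ≤ ENNReal.ofReal θ * P A + ENNReal.ofReal (1 - θ) * P B
  lowerSemicontinuous : LowerSemicontinuous P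
  map_zero : P 0 = 0

/-- The momentum equation in weak form, with initial value `V₀` and force `F₀ + Div F₁`. -/
def WeakMomentum {Ω : Set Vec} (T : EReal) (η μ : ℝ) (V₀ : L2 Ω (Fin 3)) (F₀ : ℝ → L2 Ω (Fin 3))
    (F₁ : ℝ → L2 Ω (Fin 3 × Fin 3)) (V : ℝ → L2 Ω (Fin 3)) (S : ℝ → L2dev Ω) : Prop :=
  ∀ Φ : ℝ → Vec → Vec, IsTestVelocity Ω T Φ →
    ∫ t in timeInterval T, ∫ x in Ω,
        (- inner ℝ (V t x) (deriv (fun s => Φ s x) t)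
          - inner ℝ (tensorProd (V t x) (V t x)) (grad (Φ t) x)
          + η * inner ℝ ((S t : L2 Ω (Fin 3 × Fin 3)) x) (grad (Φ t) x)
          + μ * inner ℝ (weakGrad (V t) x) (grad (Φ t) x)) =
      (∫ t in timeInterval T, ∫ x in Ω, inner ℝ (F₀ t x) (Φ t x))
        - (∫ t in timeInterval T, ∫ x in Ω, inner ℝ (F₁ t x) (grad (Φ t) x))
        + ∫ x in Ω, inner ℝ (V₀ x) (Φ 0 x)

/-- The evolutionary variational inequality on `(0, T')` for the stress, tested with `R`, whose time
derivative is `dR`. The term `∫ P(S)` is on the smaller side, so that no difference of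
infinite values occurs; every other term, apart from `∫ P(R)`, is a finite real number. -/
def VariationalIneq {Ω : Set Vec} (η γ : ℝ) (P : L2dev Ω → ENNReal) (S₀ : L2dev Ω)
    (V : ℝ → L2 Ω (Fin 3)) (S : ℝ → L2dev Ω) (T' : ℝ) (R dR : ℝ → L2dev Ω) : Prop :=
  ((∫⁻ t in Ioo 0 T', P (S t) : ENNReal) : EReal) ≤
    ((∫⁻ t in Ioo 0 T', P (R t) : ENNReal) : EReal) +
    (((∫ t in Ioo 0 T', ∫ x in Ω,
        (inner ℝ ((dR t : L2 Ω (Fin 3 × Fin 3)) x)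
            ((R t : L2 Ω (Fin 3 × Fin 3)) x - (S t : L2 Ω (Fin 3 × Fin 3)) x)
          + γ * inner ℝ (weakGrad (S t : L2 Ω (Fin 3 × Fin 3)) x)
            (weakGrad (R t : L2 Ω (Fin 3 × Fin 3)) x - weakGrad (S t : L2 Ω (Fin 3 × Fin 3)) x)))
      + (∫ t in Ioo 0 T', ∫ x in Ω,
        (inner ℝ (convect (V t x) (weakGrad (S t : L2 Ω (Fin 3 × Fin 3)) x))
            ((R t : L2 Ω (Fin 3 × Fin 3)) x)
          + inner ℝ (tensorCommutator ((S t : L2 Ω (Fin 3 × Fin 3)) x) (skewPart (weakGrad (V t) x)))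
            ((R t : L2 Ω (Fin 3 × Fin 3)) x)
          - η * inner ℝ (symPart (weakGrad (V t) x))
            ((R t : L2 Ω (Fin 3 × Fin 3)) x - (S t : L2 Ω (Fin 3 × Fin 3)) x)))
      + 1 / 2 * ‖R 0 - S₀‖ ^ 2 : ℝ) : EReal)

/-- `(V, S)` is a generalized solution on `(0, T)` of the viscoelastoplastic fluid model with
initial values `V₀`, `S₀`, force `F₀ + Div F₁` and boundary velocity `g`. -/
structure IsGeneralizedSolution {Ω : Set Vec} (T : EReal) (η μ γ : ℝ) (P : L2dev Ω → ENNReal)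
    (V₀ : L2 Ω (Fin 3)) (S₀ : L2dev Ω) (F₀ : ℝ → L2 Ω (Fin 3)) (F₁ : ℝ → L2 Ω (Fin 3 × Fin 3))
    (g : ℝ → Lp Vec 2 (surfaceMeasure Ω)) (V : ℝ → L2 Ω (Fin 3)) (S : ℝ → L2dev Ω) : Prop where
  memLH : ∀ T' ∈ timeInterval T, MemLH T' V
  memX : ∀ T' ∈ timeInterval T, MemX T' S
  boundary : ∀ᵐ t ∂(volume.restrict (timeInterval T)), HasTrace (V t) (g t)
  momentum : WeakMomentum T η μ V₀ F₀ F₁ V S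
  variational : ∀ T' ∈ timeInterval T, ∀ R dR : ℝ → L2dev Ω, MemZ T' R dR →
    VariationalIneq η γ P S₀ V S T' R dR

end ViscoFluid

open ViscoFluid

/-! Formally the inequality is the stress equation tested with `S`, but `S` has no time derivative
and need not be admissible. Instead fix a time `T'`, put `A = S T'`, and test on `(0, T')` with `R t
= ramp (T' - δ) δ t • A`, which vanishes up to `T' - δ` and then rises linearly to `A` at `T'`. The
time derivative contributes `½ ‖A‖²` minus the inner product of `A` with the mean of `S` over `(T' -
δ, T')`. If `T'` is a Lebesgue point of `S`, this tends to `½ ‖A‖² - ‖A‖² = -½ ‖S T'‖²`. Since `R 0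
= 0`, the initial term is `½ ‖S₀‖²`. By convexity and `P 0 = 0`, the potential of `R` costs at most
`δ P(A)`. Every other term with `R` carries the factor `ramp` and vanishes as `δ → 0`; what survives
is `-γ ‖∇S‖²` and `η D(V) : S`. This is `VariationalIneq.lintegral_potential_le_of_ramp` followed by
the limit in `energy_inequality_at`.

The time `T'` must be a Lebesgue point with `A ∈ H¹` and `P(A) < ∞`. Almost every time qualifies;
for the last condition, the test function `0` shows that `∫ P(S)` is finite.

The analytic work is to make `R` admissible, which needs `A ∈ L⁵`, and to make the trilinear
transport terms integrable, for which `L⁴` is enough. Both rest on the embedding of `H¹(Ω)` into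
`L⁵(Ω)` (`IsBoundedLipschitzDomain.exists_eLpNorm_five_le`). There `f x` is the limit of averages of
`f` over shrinking pieces of a cone with vertex `x` inside `Ω`. Consecutive averages differ by
integrals of the gradient over small balls, whose `L⁵` norms form a geometric series. -/

namespace ViscoFluid

/-! ### Averages over shrinking cones -/

/-- The kernel `y ↦ s⁻³ κ ((y - x) / s)`. -/
noncomputable def coneKernel (κ : Vec → ℝ) (x : Vec) (s : ℝ) (y : Vec) : ℝ :=
  s⁻¹ ^ 3 * κ (s⁻¹ • (y - x))

/-- The derivative of `coneKernel` with respect to `s`. -/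
noncomputable def coneKernelDeriv (κ : Vec → ℝ) (x : Vec) (s : ℝ) (y : Vec) : ℝ :=
  -(s⁻¹ ^ 4 * (3 * κ (s⁻¹ • (y - x)) + fderiv ℝ κ (s⁻¹ • (y - x)) (s⁻¹ • (y - x))))

theorem hasDerivAt_coneKernel {κ : Vec → ℝ} (hκ : ContDiff ℝ ∞ κ) (x y : Vec) {s : ℝ} (hs : 0 < s) :
    HasDerivAt (fun s => coneKernel κ x s y) (coneKernelDeriv κ x s y) s := by
  have h1 : HasDerivAt (fun s : ℝ => s⁻¹) (-(s ^ 2)⁻¹) s := hasDerivAt_inv hs.ne'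
  have h2 := h1.smul_const (y - x)
  have h3 := ((hκ.differentiable (by simp)) (s⁻¹ • (y - x))).hasFDerivAt.comp_hasDerivAt s h2
  refine ((h1.fun_pow 3).fun_mul h3).congr_deriv ?_
  simp only [coneKernelDeriv, map_smul, smul_eq_mul, Function.comp, Nat.add_one_sub_one, Nat.cast_ofNat]
  field_simp
  ring

/-- The derivative blows up as `s → 0`; a bound uniform for `s ≥ s₀` suffices to differentiate
averages under the integral sign. -/
theorem exists_bound_coneKernelDeriv {κ : Vec → ℝ} (hκ : ContDiff ℝ ∞ κ)
    (hc : HasCompactSupport κ) {s₀ : ℝ} (hs₀ : 0 < s₀) :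
    ∃ C, ∀ x y s, s₀ ≤ s → ‖coneKernelDeriv κ x s y‖ ≤ C := by
  have hcont : Continuous fun z => 3 * κ z + fderiv ℝ κ z z :=
    (continuous_const.mul hκ.continuous).add
      ((hκ.continuous_fderiv (by simp)).clm_apply continuous_id)
  have hcs : HasCompactSupport fun z => 3 * κ z + fderiv ℝ κ z z := by
    refine HasCompactSupport.of_support_subset_isCompact hc (fun z hz => ?_)
    by_contra h
    refine hz ?_
    have h1 : fderiv ℝ κ z = 0 := by
      by_contra h2
      exact h (support_fderiv_subset ℝ h2)
    simp [image_eq_zero_of_notMem_tsupport h, h1]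
  obtain ⟨C, hC⟩ := hcs.exists_bound_of_continuous hcont
  refine ⟨s₀⁻¹ ^ 4 * C, fun x y s hs => ?_⟩
  have hs' : 0 < s := hs₀.trans_le hs
  rw [coneKernelDeriv, norm_neg, norm_mul]
  have : ‖s⁻¹ ^ 4‖ ≤ s₀⁻¹ ^ 4 := by
    rw [Real.norm_of_nonneg (by positivity)]
    gcongr
  gcongr
  exact hC _

theorem continuous_coneKernel {κ : Vec → ℝ} (hκ : ContDiff ℝ ∞ κ) (x : Vec) (s : ℝ) :
    Continuous (coneKernel κ x s) := by
  have := hκ.continuous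
  unfold coneKernel
  fun_prop

theorem continuous_coneKernelDeriv {κ : Vec → ℝ} (hκ : ContDiff ℝ ∞ κ) (x : Vec) (s : ℝ) :
    Continuous (coneKernelDeriv κ x s) := by
  have := hκ.continuous
  have h2 := hκ.continuous_fderiv (by simp)
  unfold coneKernelDeriv
  have h3 : Continuous fun y : Vec => s⁻¹ • (y - x) := by fun_prop
  have h4 : Continuous fun y : Vec => fderiv ℝ κ (s⁻¹ • (y - x)) (s⁻¹ • (y - x)) :=
    (h2.comp h3).clm_apply h3
  fun_prop

theorem hasDerivAt_integral_coneKernel {κ : Vec → ℝ} (hκ : ContDiff ℝ ∞ κ)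
    (hc : HasCompactSupport κ) {μ : Measure Vec} {f : Vec → ℝ} (hf : Integrable f μ) (x : Vec)
    {s : ℝ} (hs : 0 < s) :
    HasDerivAt (fun s => ∫ y, coneKernel κ x s y * f y ∂μ) (∫ y, coneKernelDeriv κ x s y * f y ∂μ)
      s := by
  obtain ⟨C, hC⟩ := exists_bound_coneKernelDeriv hκ hc (half_pos hs)
  obtain ⟨C', hC'⟩ := hc.exists_bound_of_continuous hκ.continuous
  refine (hasDerivAt_integral_of_dominated_loc_of_deriv_le (bound := fun y => C * ‖f y‖)
    (F := fun s y => coneKernel κ x s y * f y) (F' := fun s y => coneKernelDeriv κ x s y * f y)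
    (Ioi_mem_nhds (half_lt_self hs)) (Eventually.of_forall fun t =>
      (continuous_coneKernel hκ x t).aestronglyMeasurable.mul hf.1) ?_
    ((continuous_coneKernelDeriv hκ x s).aestronglyMeasurable.mul hf.1) ?_ (hf.norm.const_mul _)
    ?_).2
  · refine hf.bdd_mul (c := s⁻¹ ^ 3 * C') (continuous_coneKernel hκ x s).aestronglyMeasurable
      (Eventually.of_forall fun y => ?_)
    rw [coneKernel, norm_mul, Real.norm_of_nonneg (by positivity : (0 : ℝ) ≤ s⁻¹ ^ 3)]
    gcongr
    exact hC' _
  · refine Eventually.of_forall fun y t ht => ?_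
    rw [norm_mul]
    gcongr
    exact hC _ _ _ (le_of_lt ht)
  · refine Eventually.of_forall fun y t ht => ?_
    exact (hasDerivAt_coneKernel hκ x y ((half_pos hs).trans ht)).mul_const _

/-- The test field whose divergence is `- coneKernelDeriv`. -/
noncomputable def coneField (κ : Vec → ℝ) (x : Vec) (s : ℝ) (j : Fin 3) (y : Vec) : ℝ :=
  s⁻¹ ^ 4 * ((y - x) j * κ (s⁻¹ • (y - x)))

theorem contDiff_coneField {κ : Vec → ℝ} (hκ : ContDiff ℝ ∞ κ) (x : Vec) (s : ℝ) (j : Fin 3) :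
    ContDiff ℝ ∞ (coneField κ x s j) := by
  have h : ContDiff ℝ ∞ fun y : Vec => s⁻¹ • (y - x) := by fun_prop
  have h2 : ContDiff ℝ ∞ fun y : Vec => (y - x) j := by fun_prop
  exact contDiff_const.mul (h2.mul (hκ.comp h))

theorem tsupport_coneField_subset {κ : Vec → ℝ} {w₀ : Vec} {ρ : ℝ}
    (hsupp : Function.support κ ⊆ Metric.closedBall w₀ ρ) (x : Vec) {s : ℝ} (hs : 0 < s)
    (j : Fin 3) :
    tsupport (coneField κ x s j) ⊆ (fun w => x + s • w) '' Metric.closedBall w₀ ρ := by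
  have hK : IsCompact ((fun w : Vec => x + s • w) '' Metric.closedBall w₀ ρ) :=
    (isCompact_closedBall w₀ ρ).image (by fun_prop)
  refine closure_minimal (fun y hy => ?_) hK.isClosed
  refine ⟨s⁻¹ • (y - x), hsupp fun h => hy ?_, ?_⟩
  · simp [coneField, h]
  · simp [smul_smul, hs.ne']

/-- The kernels are transported by the dilations about `x`, with velocity `(y - x) / s`, and
`coneField` is the flux. This is their continuity equation. -/
theorem sum_fderiv_coneField {κ : Vec → ℝ} (hκ : ContDiff ℝ ∞ κ) (x y : Vec) {s : ℝ} :
    ∑ j, fderiv ℝ (coneField κ x s j) y (EuclideanSpace.single j 1) = - coneKernelDeriv κ x s y := by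
  have h1 (j : Fin 3) : HasFDerivAt (fun y : Vec => (y - x) j)
      (EuclideanSpace.proj j : Vec →L[ℝ] ℝ) y := by
    have := ((EuclideanSpace.proj j : Vec →L[ℝ] ℝ).hasFDerivAt (x := y)).sub_const (x j)
    exact this
  have h2 : HasFDerivAt (fun y : Vec => s⁻¹ • (y - x)) (s⁻¹ • ContinuousLinearMap.id ℝ Vec) y :=
    ((hasFDerivAt_id y).sub_const x).const_smul s⁻¹
  have h3 := (((hκ.differentiable (by simp)) (s⁻¹ • (y - x))).hasFDerivAt.comp y h2)
  have h4 (j : Fin 3) : fderiv ℝ (coneField κ x s j) y (EuclideanSpace.single j 1) =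
      s⁻¹ ^ 4 * (κ (s⁻¹ • (y - x)) + (y - x) j *
        (s⁻¹ * fderiv ℝ κ (s⁻¹ • (y - x)) (EuclideanSpace.single j 1))) := by
    have := (((h1 j).fun_mul h3).const_mul (s⁻¹ ^ 4)).fderiv
    unfold coneField
    simp only [Function.comp_def] at this
    rw [this]
    simp
    ring
  have h5 : (y - x) = ∑ j, (y - x) j • (EuclideanSpace.single j (1 : ℝ) : Vec) := by
    ext i
    simp [Finset.sum_apply, Pi.single_apply]
  have h6 : fderiv ℝ κ (s⁻¹ • (y - x)) (s⁻¹ • (y - x)) =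
      ∑ j, (y - x) j * (s⁻¹ * fderiv ℝ κ (s⁻¹ • (y - x)) (EuclideanSpace.single j 1)) := by
    conv_lhs => rw [map_smul]; arg 2; arg 2; rw [h5]
    rw [map_sum, smul_eq_mul, Finset.mul_sum]
    refine Finset.sum_congr rfl fun j _ => ?_
    rw [map_smul, smul_eq_mul]; ring
  simp only [h4, coneKernelDeriv, neg_neg, h6, ← Finset.mul_sum, Finset.sum_add_distrib]
  simp

/-- Since `coneKernelDeriv` is minus a divergence, the weak derivative can be moved onto `f`. The
cone condition places the support of the test field inside `Ω`. The factor `y - x`, of size `s` on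
that support, gains one power of `s`. -/
theorem integral_coneKernelDeriv_mul {κ : Vec → ℝ} (hκ : ContDiff ℝ ∞ κ) {w₀ : Vec} {ρ : ℝ}
    (hsupp : Function.support κ ⊆ Metric.closedBall w₀ ρ) {Ω : Set Vec} {f : Vec → ℝ} {g : Vec → Vec}
    (hf : IntegrableOn f Ω) (hg : IntegrableOn g Ω)
    (hweak : ∀ φ : Vec → ℝ, ContDiff ℝ ∞ φ → HasCompactSupport φ → tsupport φ ⊆ Ω → ∀ j : Fin 3,
      ∫ x in Ω, f x * fderiv ℝ φ x (EuclideanSpace.single j 1) = - ∫ x in Ω, g x j * φ x)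
    {x : Vec} {s : ℝ} (hs : 0 < s) (hcone : ∀ w ∈ Metric.closedBall w₀ ρ, x + s • w ∈ Ω) :
    ∫ y in Ω, coneKernelDeriv κ x s y * f y =
      ∫ y in Ω, s⁻¹ ^ 4 * (κ (s⁻¹ • (y - x)) * inner ℝ (y - x) (g y)) := by
  have hsub (j : Fin 3) : tsupport (coneField κ x s j) ⊆ Ω :=
    (tsupport_coneField_subset hsupp x hs j).trans (by rintro _ ⟨w, hw, rfl⟩; exact hcone w hw)
  have hcpt (j : Fin 3) : HasCompactSupport (coneField κ x s j) :=
    HasCompactSupport.of_support_subset_isCompact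
      ((isCompact_closedBall w₀ ρ).image (f := fun w : Vec => x + s • w) (by fun_prop))
      ((subset_tsupport _).trans (tsupport_coneField_subset hsupp x hs j))
  have hsm (j : Fin 3) := contDiff_coneField hκ x s j
  have hi1 (j : Fin 3) : IntegrableOn
      (fun y => f y * fderiv ℝ (coneField κ x s j) y (EuclideanSpace.single j 1)) Ω := by
    have hc : Continuous fun y => fderiv ℝ (coneField κ x s j) y (EuclideanSpace.single j 1) :=
      ((hsm j).continuous_fderiv (by simp)).clm_apply continuous_const
    obtain ⟨C, hC⟩ := ((hcpt j).fderiv_apply (𝕜 := ℝ)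
      (EuclideanSpace.single j 1)).exists_bound_of_continuous hc
    exact hf.mul_bdd (c := C) hc.aestronglyMeasurable (Eventually.of_forall hC)
  have hi2 (j : Fin 3) : IntegrableOn (fun y => g y j * coneField κ x s j y) Ω := by
    obtain ⟨C, hC⟩ := (hcpt j).exists_bound_of_continuous (hsm j).continuous
    have hgj : IntegrableOn (fun y => g y j) Ω :=
      (EuclideanSpace.proj j : Vec →L[ℝ] ℝ).integrable_comp hg
    exact hgj.mul_bdd (c := C) (hsm j).continuous.aestronglyMeasurable (Eventually.of_forall hC)
  calc ∫ y in Ω, coneKernelDeriv κ x s y * f y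
      = ∫ y in Ω, -∑ j, f y * fderiv ℝ (coneField κ x s j) y (EuclideanSpace.single j 1) := by
        congr 1; ext y
        rw [← Finset.mul_sum, sum_fderiv_coneField hκ]; ring
    _ = ∑ j, ∫ y in Ω, g y j * coneField κ x s j y := by
        rw [integral_neg, integral_finsetSum _ fun j _ => hi1 j, ← Finset.sum_neg_distrib]
        refine Finset.sum_congr rfl fun j _ => ?_
        rw [hweak _ (hsm j) (hcpt j) (hsub j), neg_neg]
    _ = _ := by
        rw [← integral_finsetSum _ fun j _ => hi2 j]
        congr 1; ext y
        simp only [coneField, PiLp.inner_apply, Finset.mul_sum]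
        refine Finset.sum_congr rfl fun j _ => ?_
        simp; ring

theorem enorm_integral_coneKernelDeriv_mul_le {κ : Vec → ℝ} (hκ : ContDiff ℝ ∞ κ) {w₀ : Vec}
    {ρ : ℝ} (hsupp : Function.support κ ⊆ Metric.closedBall w₀ ρ) {Ω : Set Vec}
    (hΩ : MeasurableSet Ω) {f : Vec → ℝ}
    {g : Vec → Vec} (hf : IntegrableOn f Ω) (hg : IntegrableOn g Ω)
    (hweak : ∀ φ : Vec → ℝ, ContDiff ℝ ∞ φ → HasCompactSupport φ → tsupport φ ⊆ Ω → ∀ j : Fin 3,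
      ∫ x in Ω, f x * fderiv ℝ φ x (EuclideanSpace.single j 1) = - ∫ x in Ω, g x j * φ x)
    {M R : ℝ} (hM : ∀ z, ‖κ z‖ ≤ M) (hR : ‖w₀‖ + ρ ≤ R)
    {x : Vec} {s : ℝ} (hs : 0 < s) (hcone : ∀ w ∈ Metric.closedBall w₀ ρ, x + s • w ∈ Ω) :
    ‖∫ y in Ω, coneKernelDeriv κ x s y * f y‖ₑ ≤
      ENNReal.ofReal (s⁻¹ ^ 3 * M * R) *
        ∫⁻ y in Metric.closedBall x (R * s), Ω.indicator (fun y => ‖g y‖ₑ) y := by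
  rw [integral_coneKernelDeriv_mul hκ hsupp hf hg hweak hs hcone]
  have hM0 : 0 ≤ M := (norm_nonneg _).trans (hM 0)
  refine (enorm_integral_le_lintegral_enorm _).trans ?_
  rw [← lintegral_const_mul' _ _ ENNReal.ofReal_ne_top, ← lintegral_indicator hΩ,
    ← lintegral_indicator measurableSet_closedBall]
  refine lintegral_mono fun y => ?_
  by_cases hy : y ∈ Ω
  · rw [indicator_of_mem hy]
    by_cases hz : κ (s⁻¹ • (y - x)) = 0
    · simp [hz]
    have hz' := hsupp hz
    have h1 : ‖s⁻¹ • (y - x)‖ ≤ R := by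
      have := norm_le_norm_add_norm_sub' (s⁻¹ • (y - x)) w₀
      rw [mem_closedBall_iff_norm] at hz'
      linarith
    have h2 : ‖y - x‖ ≤ R * s := by
      rw [norm_smul, norm_inv, Real.norm_of_nonneg hs.le] at h1
      rwa [inv_mul_le_iff₀ hs, mul_comm] at h1
    rw [indicator_of_mem (by rwa [mem_closedBall_iff_norm]), indicator_of_mem hy,
      ← ofReal_norm, ← ofReal_norm,
      ← ENNReal.ofReal_mul' (norm_nonneg _)]
    refine ENNReal.ofReal_le_ofReal ?_
    have h3 : ‖(inner ℝ (y - x) (g y) : ℝ)‖ ≤ R * s * ‖g y‖ :=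
      (norm_inner_le_norm _ _).trans (by gcongr)
    rw [norm_mul, norm_mul, Real.norm_of_nonneg (by positivity : (0 : ℝ) ≤ s⁻¹ ^ 4)]
    calc s⁻¹ ^ 4 * (‖κ (s⁻¹ • (y - x))‖ * ‖(inner ℝ (y - x) (g y) : ℝ)‖)
        ≤ s⁻¹ ^ 4 * (M * (R * s * ‖g y‖)) := by gcongr; exact hM _
      _ = _ := by field_simp
  · rw [indicator_of_notMem hy]; exact zero_le

/-- The mean value inequality with extended norms, so that integrals of the gradient can serve as
`C` without a proof that they are finite. -/
theorem enorm_sub_le_of_enorm_deriv_le {m m' : ℝ → ℝ} {a b : ℝ} (hab : a ≤ b) {C : ENNReal}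
    (hd : ∀ s ∈ Icc a b, HasDerivAt m (m' s) s) (hb : ∀ s ∈ Icc a b, ‖m' s‖ₑ ≤ C) :
    ‖m a - m b‖ₑ ≤ C * ENNReal.ofReal (b - a) := by
  rcases hab.eq_or_lt with rfl | hab'
  · simp
  rcases eq_or_ne C ⊤ with rfl | hC
  · rw [ENNReal.top_mul]
    · exact le_top
    · simpa using hab'
  have := (convex_Icc a b).norm_image_sub_le_of_norm_hasDerivWithin_le
    (fun s hs => (hd s hs).hasDerivWithinAt) (C := C.toReal)
    (fun s hs => by
      have := ENNReal.toReal_mono hC (hb s hs)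
      rwa [toReal_enorm] at this) (right_mem_Icc.2 hab) (left_mem_Icc.2 hab)
  rw [← ofReal_norm]
  refine (ENNReal.ofReal_le_ofReal this).trans ?_
  rw [ENNReal.ofReal_mul ENNReal.toReal_nonneg, ENNReal.ofReal_toReal hC, norm_sub_rev,
    Real.norm_of_nonneg (by linarith)]

/-- The scales `2 ^ (-10 k)`. -/
noncomputable def scale (k : ℕ) : ℝ := ((1 / 2 : ℝ) ^ k) ^ 10

theorem scale_pos (k : ℕ) : 0 < scale k := by unfold scale; positivity

theorem scale_le_one (k : ℕ) : scale k ≤ 1 :=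
  pow_le_one₀ (by positivity) (pow_le_one₀ (by norm_num) (by norm_num))

theorem scale_succ (k : ℕ) : scale (k + 1) = scale k / 1024 := by
  unfold scale; rw [pow_succ (1 / 2 : ℝ) k, mul_pow]; norm_num; ring

theorem tendsto_scale : Tendsto scale atTop (𝓝 0) := by
  have := (tendsto_pow_atTop_nhds_zero_of_lt_one (r := (1 / 2 : ℝ)) (by norm_num)
    (by norm_num)).pow 10
  unfold scale; convert this using 2; norm_num

theorem enorm_integral_coneKernel_sub_le {κ : Vec → ℝ} (hκ : ContDiff ℝ ∞ κ)
    (hc : HasCompactSupport κ) {w₀ : Vec}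
    {ρ : ℝ} (hρ : 0 ≤ ρ) (hsupp : Function.support κ ⊆ Metric.closedBall w₀ ρ) {Ω : Set Vec}
    (hΩ : MeasurableSet Ω) {f : Vec → ℝ}
    {g : Vec → Vec} (hf : IntegrableOn f Ω) (hg : IntegrableOn g Ω)
    (hweak : ∀ φ : Vec → ℝ, ContDiff ℝ ∞ φ → HasCompactSupport φ → tsupport φ ⊆ Ω → ∀ j : Fin 3,
      ∫ x in Ω, f x * fderiv ℝ φ x (EuclideanSpace.single j 1) = - ∫ x in Ω, g x j * φ x)
    {M R : ℝ} (hM : ∀ z, ‖κ z‖ ≤ M) (hR : ‖w₀‖ + ρ ≤ R)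
    {x : Vec} (hcone : ∀ s ∈ Ioc (0 : ℝ) 1, ∀ w ∈ Metric.closedBall w₀ ρ, x + s • w ∈ Ω) (k : ℕ) :
    ‖(∫ y in Ω, coneKernel κ x (scale (k + 1)) y * f y) -
        ∫ y in Ω, coneKernel κ x (scale k) y * f y‖ₑ ≤
      ENNReal.ofReal (1024 ^ 3 * M * R) * (ENNReal.ofReal ((scale k)⁻¹ ^ 2) *
        ∫⁻ y in Metric.closedBall x (R * scale k), Ω.indicator (fun y => ‖g y‖ₑ) y) := by
  have hM0 : 0 ≤ M := (norm_nonneg _).trans (hM 0)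
  have hR0 : 0 ≤ R := by have := norm_nonneg w₀; linarith
  have hk := scale_pos k
  have hk1 := scale_pos (k + 1)
  have hs := scale_succ k
  set H := ∫⁻ y in Metric.closedBall x (R * scale k), Ω.indicator (fun y => ‖g y‖ₑ) y
  refine (enorm_sub_le_of_enorm_deriv_le (C := ENNReal.ofReal ((scale (k + 1))⁻¹ ^ 3 * M * R) * H)
    (m := fun s => ∫ y in Ω, coneKernel κ x s y * f y) (by rw [hs]; linarith)
    (fun s hs => hasDerivAt_integral_coneKernel hκ hc hf x (hk1.trans_le hs.1))
    (fun s hs => ?_)).trans ?_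
  · have hs0 := hk1.trans_le hs.1
    refine (enorm_integral_coneKernelDeriv_mul_le hκ hsupp hΩ hf hg hweak hM hR hs0
      (hcone s ⟨hs0, hs.2.trans (scale_le_one k)⟩)).trans ?_
    have hmono : ∫⁻ y in Metric.closedBall x (R * s), Ω.indicator (fun y => ‖g y‖ₑ) y ≤ H :=
      lintegral_mono_set (Metric.closedBall_subset_closedBall (by gcongr; exact hs.2))
    gcongr
    exact hs.1
  · rw [mul_right_comm, ← ENNReal.ofReal_mul (by positivity), ← mul_assoc,
      ← ENNReal.ofReal_mul (by positivity)]
    -- The length of the step between the scales is at most `scale k`, and passing from `scale (k +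
    -- 1)` to `scale k` in the cubed inverse costs `1024 ^ 3`.
    refine mul_le_mul_left (ENNReal.ofReal_le_ofReal ?_) _
    rw [hs]
    calc (scale k / 1024)⁻¹ ^ 3 * M * R * (scale k - scale k / 1024)
        ≤ (scale k / 1024)⁻¹ ^ 3 * M * R * scale k := by gcongr; linarith
      _ = _ := by field_simp


/-! ### `L²` to `L⁵` bounds for integrals over small balls -/

theorem measurable_lintegral_closedBall {G : Vec → ENNReal} (hG : Measurable G) (r : ℝ) :
    Measurable fun x => ∫⁻ y in Metric.closedBall x r, G y := by
  have : (fun x => ∫⁻ y in Metric.closedBall x r, G y) =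
      fun x => ∫⁻ y, {p : Vec × Vec | dist p.2 p.1 ≤ r}.indicator (fun p => G p.2) (x, y) := by
    ext x
    rw [← lintegral_indicator measurableSet_closedBall]
    rfl
  rw [this]
  refine Measurable.lintegral_prod_right' (f := fun p : Vec × Vec =>
    {p : Vec × Vec | dist p.2 p.1 ≤ r}.indicator (fun p => G p.2) p) ?_
  exact (hG.comp measurable_snd).indicator
    (measurableSet_le (measurable_snd.dist measurable_fst) measurable_const)

theorem lintegral_lintegral_closedBall {G : Vec → ENNReal} (hG : Measurable G) (r : ℝ) :
    ∫⁻ x, ∫⁻ y in Metric.closedBall x r, G y =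
      volume (Metric.closedBall (0 : Vec) r) * ∫⁻ y, G y := by
  have hm : Measurable fun p : Vec × Vec =>
      {p : Vec × Vec | dist p.2 p.1 ≤ r}.indicator (fun p => G p.2) p :=
    (hG.comp measurable_snd).indicator
      (measurableSet_le (measurable_snd.dist measurable_fst) measurable_const)
  have h1 (x : Vec) : ∫⁻ y in Metric.closedBall x r, G y =
      ∫⁻ y, {p : Vec × Vec | dist p.2 p.1 ≤ r}.indicator (fun p => G p.2) (x, y) := by
    rw [← lintegral_indicator measurableSet_closedBall]; rfl
  simp_rw [h1]
  rw [lintegral_lintegral_swap hm.aemeasurable, ← lintegral_const_mul _ hG]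
  congr 1; ext y
  have h2 : (fun x => {p : Vec × Vec | dist p.2 p.1 ≤ r}.indicator (fun p => G p.2) (x, y)) =
      (Metric.closedBall y r).indicator fun _ => G y := by
    ext x
    simp only [indicator, mem_ofPred_eq, Metric.mem_closedBall, dist_comm x y]
  rw [h2, lintegral_indicator measurableSet_closedBall, setLIntegral_const,
    Measure.addHaar_closedBall_center, mul_comm]

theorem lintegral_sq_le_of_measure {G : Vec → ENNReal} (hG : Measurable G) (s : Set Vec) :
    (∫⁻ y in s, G y) ^ 2 ≤ volume s * ∫⁻ y in s, G y ^ 2 := by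
  have h := ENNReal.lintegral_mul_le_Lp_mul_Lq (volume.restrict s) Real.HolderConjugate.two_two
    (f := fun _ => 1) (g := G) aemeasurable_const hG.aemeasurable
  have h2 : ∫⁻ y in s, G y ≤ (volume s) ^ (1 / 2 : ℝ) * (∫⁻ y in s, G y ^ 2) ^ (1 / 2 : ℝ) := by
    simpa using h
  calc (∫⁻ y in s, G y) ^ 2
      ≤ ((volume s) ^ (1 / 2 : ℝ) * (∫⁻ y in s, G y ^ 2) ^ (1 / 2 : ℝ)) ^ 2 := by gcongr
    _ = _ := by
      rw [mul_pow, ← ENNReal.rpow_natCast, ← ENNReal.rpow_natCast, ← ENNReal.rpow_mul,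
        ← ENNReal.rpow_mul]
      norm_num

/-- Interpolation between two consequences of Cauchy–Schwarz, with `B` the ball: the supremum is at
most `|B|^(1/2) ‖G‖₂` and the `L²` norm at most `|B| ‖G‖₂`. Splitting the fifth power as `3 + 2`
gives `|B|^(7/10)`. The tenth root `c` of the volume keeps all exponents integral. -/
theorem eLpNorm_lintegral_closedBall_le {G : Vec → ENNReal} (hG : Measurable G) {r : ℝ}
    {c : ENNReal} (hc : volume (Metric.closedBall (0 : Vec) r) = c ^ 10) :
    eLpNorm (fun x => ∫⁻ y in Metric.closedBall x r, G y) 5 volume ≤ c ^ 7 * eLpNorm G 2 volume := by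
  set N := eLpNorm G 2 volume with hN
  have hN2 : ∫⁻ y, G y ^ 2 = N ^ 2 := by
    rw [hN, eLpNorm_eq_lintegral_rpow_enorm_toReal (by norm_num) (by norm_num),
      ← ENNReal.rpow_natCast, ← ENNReal.rpow_mul]
    simp
  set H := fun x => ∫⁻ y in Metric.closedBall x r, G y
  have hH2 (x : Vec) : H x ^ 2 ≤ c ^ 10 * ∫⁻ y in Metric.closedBall x r, G y ^ 2 := by
    rw [← hc, ← Measure.addHaar_closedBall_center volume x]
    exact lintegral_sq_le_of_measure hG _
  have hsup (x : Vec) : H x ≤ c ^ 5 * N := by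
    refine (ENNReal.pow_le_pow_left_iff (n := 2) two_ne_zero).1 ((hH2 x).trans ?_)
    rw [mul_pow, ← pow_mul, ← hN2]
    gcongr
    exact Measure.restrict_le_self
  have hint : ∫⁻ x, H x ^ 2 ≤ c ^ 20 * N ^ 2 := by
    refine (lintegral_mono hH2).trans ?_
    rw [lintegral_const_mul _ (measurable_lintegral_closedBall (hG.pow_const 2) r),
      lintegral_lintegral_closedBall (hG.pow_const 2), hc, hN2, ← mul_assoc, ← pow_add]
  have h5 : ∫⁻ x, H x ^ 5 ≤ (c ^ 7 * N) ^ 5 := by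
    calc ∫⁻ x, H x ^ 5 ≤ ∫⁻ x, (c ^ 5 * N) ^ 3 * H x ^ 2 := by
          refine lintegral_mono fun x => ?_
          rw [show H x ^ 5 = H x ^ 3 * H x ^ 2 by ring]
          gcongr
          exact hsup x
      _ = (c ^ 5 * N) ^ 3 * ∫⁻ x, H x ^ 2 :=
          lintegral_const_mul _ ((measurable_lintegral_closedBall hG r).pow_const 2)
      _ ≤ (c ^ 5 * N) ^ 3 * (c ^ 20 * N ^ 2) := by gcongr
      _ = _ := by ring
  rw [eLpNorm_eq_lintegral_rpow_enorm_toReal (by norm_num) (by norm_num)]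
  simp only [enorm_eq_self, ENNReal.toReal_ofNat, one_div]
  refine (ENNReal.rpow_inv_le_iff (by norm_num)).2 ?_
  rw [show (5 : ℝ) = ((5 : ℕ) : ℝ) by norm_num]
  simpa only [ENNReal.rpow_natCast] using h5

theorem volume_closedBall_scale (R : ℝ) (hR : 0 ≤ R) (k : ℕ) :
    volume (Metric.closedBall (0 : Vec) (R * scale k)) =
      ((volume (Metric.closedBall (0 : Vec) R)) ^ (1 / 10 : ℝ) *
        (ENNReal.ofReal ((1 / 2) ^ k)) ^ 3) ^ 10 := by
  rw [mul_comm, Measure.addHaar_closedBall_mul _ _ (scale_pos k).le hR, mul_pow,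
    ← ENNReal.rpow_natCast, ← ENNReal.rpow_mul, mul_comm]
  congr 1
  · norm_num
  · rw [← pow_mul, ← ENNReal.ofReal_pow (by positivity)]
    simp only [finrank_euclideanSpace, Fintype.card_fin, scale]
    ring_nf

/-- For a ball of radius proportional to `s`, the power `|B|^(7/10)` is of order `s^(21/10)`, which
beats the factor `s⁻²` by `s^(1/10)`. The scales `2 ^ (-10 k)` turn this surplus into `2 ^ (-k)`. -/
theorem eLpNorm_scale_mul_lintegral_closedBall_le {G : Vec → ENNReal} (hG : Measurable G) {R : ℝ}
    (hR : 0 ≤ R) (k : ℕ) :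
    eLpNorm (fun x => ENNReal.ofReal ((scale k)⁻¹ ^ 2) *
        ∫⁻ y in Metric.closedBall x (R * scale k), G y) 5 volume ≤
      ((volume (Metric.closedBall (0 : Vec) R)) ^ (1 / 10 : ℝ)) ^ 7 * eLpNorm G 2 volume *
        ENNReal.ofReal ((1 / 2) ^ k) := by
  have h := eLpNorm_lintegral_closedBall_le hG (volume_closedBall_scale R hR k)
  set b := (volume (Metric.closedBall (0 : Vec) R)) ^ (1 / 10 : ℝ)
  set N := eLpNorm G 2 volume
  have hq : (0 : ℝ) < (1 / 2) ^ k := by positivity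
  have hsc : scale k = ((1 / 2) ^ k) ^ 10 := rfl
  set q : ℝ := (1 / 2) ^ k
  have hs : eLpNorm (fun x => ENNReal.ofReal ((scale k)⁻¹ ^ 2) *
        ∫⁻ y in Metric.closedBall x (R * scale k), G y) 5 volume =
      ENNReal.ofReal ((scale k)⁻¹ ^ 2) *
        eLpNorm (fun x => ∫⁻ y in Metric.closedBall x (R * scale k), G y) 5 volume := by
    rw [eLpNorm_eq_lintegral_rpow_enorm_toReal (by norm_num) (by norm_num),
      eLpNorm_eq_lintegral_rpow_enorm_toReal (by norm_num) (by norm_num)]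
    simp only [enorm_eq_self, ENNReal.toReal_ofNat]
    simp_rw [ENNReal.mul_rpow_of_nonneg _ _ (by norm_num : (0 : ℝ) ≤ 5)]
    rw [lintegral_const_mul _ ((measurable_lintegral_closedBall hG _).pow_const _),
      ENNReal.mul_rpow_of_nonneg _ _ (by norm_num), ← ENNReal.rpow_mul]
    norm_num
  rw [hs]
  calc _ ≤ ENNReal.ofReal ((scale k)⁻¹ ^ 2) * ((b * ENNReal.ofReal q ^ 3) ^ 7 * N) := by gcongr
    _ = b ^ 7 * N * (ENNReal.ofReal ((scale k)⁻¹ ^ 2) * ENNReal.ofReal q ^ 21) := by ring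
    _ = _ := by
      rw [← ENNReal.ofReal_pow hq.le, ← ENNReal.ofReal_mul (by positivity), hsc]
      congr 2
      field_simp

/-! ### Recovery of a function from its cone averages -/

theorem integral_coneKernel {κ : Vec → ℝ} (hint : ∫ z, κ z = 1) (x : Vec) {s : ℝ} (hs : 0 < s) :
    ∫ y, coneKernel κ x s y = 1 := by
  unfold coneKernel
  rw [integral_const_mul, integral_sub_right_eq_self (fun y => κ (s⁻¹ • y)),
    Measure.integral_comp_inv_smul, hint]
  simp only [finrank_euclideanSpace, Fintype.card_fin, smul_eq_mul, mul_one]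
  rw [abs_of_pos (by positivity)]
  field_simp

/-- Lebesgue differentiation for `f` extended by zero. The kernels need not be centred at `x`: it is
enough that they have integral one, live in balls about `x`, and are bounded by a constant over the
volume of these balls. -/
theorem ae_tendsto_integral_coneKernel {κ : Vec → ℝ} (hint : ∫ z, κ z = 1) {R M : ℝ} (hR : 0 < R)
    (hsupp : Function.support κ ⊆ Metric.closedBall 0 R) (hM : ∀ z, ‖κ z‖ ≤ M) {Ω : Set Vec}
    (hΩ : MeasurableSet Ω) {f : Vec → ℝ} (hf : IntegrableOn f Ω) :
    ∀ᵐ x ∂(volume.restrict Ω),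
      Tendsto (fun k => ∫ y in Ω, coneKernel κ x (scale k) y * f y) atTop (𝓝 (f x)) := by
  have hf' : Integrable (Ω.indicator f) := (integrable_indicator_iff hΩ).2 hf
  have h := (Besicovitch.vitaliFamily (volume : Measure Vec)).ae_tendsto_average_norm_sub
    hf'.locallyIntegrable
  filter_upwards [ae_restrict_of_ae h, ae_restrict_mem hΩ] with x hx hxΩ
  have hr : Tendsto (fun k => R * scale k) atTop (𝓝[>] 0) := by
    refine tendsto_nhdsWithin_iff.2 ⟨by simpa using tendsto_scale.const_mul R,
      Eventually.of_forall fun k => mul_pos hR (scale_pos k)⟩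
  have h1 := (hx.comp (Besicovitch.tendsto_filterAt volume x)).comp hr
  have h2 := tendsto_integral_smul_of_tendsto_average_norm_sub
    (g := fun k y => coneKernel κ x (scale k) y)
    (M * volume.real (Metric.closedBall (0 : Vec) R)) h1
    (Eventually.of_forall fun k => hf'.integrableOn)
    (by simp only [integral_coneKernel hint x (scale_pos _)]; exact tendsto_const_nhds)
    (Eventually.of_forall fun k y hy => ?_) (Eventually.of_forall fun k y => ?_)
  · rw [indicator_of_mem hxΩ] at h2
    refine h2.congr fun k => ?_
    rw [← integral_indicator hΩ]
    congr 1; ext y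
    by_cases hy : y ∈ Ω <;> simp [hy]
  · have hz : κ ((scale k)⁻¹ • (y - x)) ≠ 0 := fun h => hy (by simp [coneKernel, h])
    have hz' := hsupp hz
    rw [mem_closedBall_zero_iff, norm_smul, norm_inv, Real.norm_of_nonneg (scale_pos k).le,
      inv_mul_le_iff₀ (scale_pos k), mul_comm] at hz'
    rwa [mem_closedBall_iff_norm]
  · have hv : volume.real (Metric.closedBall x (R * scale k)) =
        scale k ^ 3 * volume.real (Metric.closedBall (0 : Vec) R) := by
      rw [measureReal_def, Measure.addHaar_closedBall_center, mul_comm,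
        Measure.addHaar_closedBall_mul _ _ (scale_pos k).le hR.le, ENNReal.toReal_mul,
        ENNReal.toReal_ofReal (by have := scale_pos k; positivity)]
      simp [measureReal_def]
    have hv0 : 0 < volume.real (Metric.closedBall (0 : Vec) R) :=
      ENNReal.toReal_pos (Metric.measure_closedBall_pos _ _ hR).ne' measure_closedBall_lt_top.ne
    have hs := scale_pos k
    rw [hv, mul_div_mul_right _ _ hv0.ne', coneKernel, abs_mul, abs_of_pos (by positivity),
      div_eq_inv_mul, inv_pow]
    gcongr
    exact hM _

/-- Minkowski's inequality for the partial sums, then Fatou's lemma for the infinite sum. -/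
theorem eLpNorm_le_of_tendsto_of_enorm_le {α : Type*} [MeasurableSpace α] {μ : Measure α}
    {f : α → ℝ} {a : ENNReal} {h : ℕ → α → ENNReal} (hh : ∀ k, Measurable (h k)) {B : ENNReal}
    (hf : ∀ᵐ x ∂μ, ‖f x‖ₑ ≤ a + ∑' k, h k x) (hB : ∑' k, eLpNorm (h k) 5 μ ≤ B) :
    eLpNorm f 5 μ ≤ a * μ univ ^ (1 / 5 : ℝ) + B := by
  set F : ℕ → α → ENNReal := fun n x => a + ∑ k ∈ Finset.range n, h k x
  have hFm (n : ℕ) : Measurable (F n) :=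
    measurable_const.add (Finset.measurable_fun_sum _ fun k _ => hh k)
  have hF (n : ℕ) : eLpNorm (F n) 5 μ ≤ a * μ univ ^ (1 / 5 : ℝ) + B := by
    have h1 : F n = (fun _ => a) + ∑ k ∈ Finset.range n, h k := by
      ext x; simp [F]
    rw [h1]
    refine (eLpNorm_add_le aestronglyMeasurable_const
      (Finset.aestronglyMeasurable_sum _ fun k _ => (hh k).aestronglyMeasurable)
      (by norm_num)).trans ?_
    gcongr
    · rw [eLpNorm_eq_lintegral_rpow_enorm_toReal (by norm_num) (by norm_num)]
      simp only [enorm_eq_self, lintegral_const, ENNReal.toReal_ofNat]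
      rw [ENNReal.mul_rpow_of_nonneg _ _ (by norm_num), ← ENNReal.rpow_mul]
      norm_num
    · refine (eLpNorm_sum_le (fun k _ => (hh k).aestronglyMeasurable) (by norm_num)).trans ?_
      exact (ENNReal.sum_le_tsum _).trans hB
  have hlim (x : α) : Tendsto (fun n => F n x) atTop (𝓝 (a + ∑' k, h k x)) :=
    tendsto_const_nhds.add ENNReal.summable.hasSum.tendsto_sum_nat
  rw [eLpNorm_eq_lintegral_rpow_enorm_toReal (by norm_num) (by norm_num), one_div,
    ENNReal.rpow_inv_le_iff (by norm_num)]
  calc ∫⁻ x, ‖f x‖ₑ ^ (ENNReal.toReal 5) ∂μ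
      ≤ ∫⁻ x, liminf (fun n => F n x ^ (ENNReal.toReal 5)) atTop ∂μ := by
        refine lintegral_mono_ae ?_
        filter_upwards [hf] with x hx
        have h1 : Tendsto (fun n => F n x ^ (ENNReal.toReal 5)) atTop
            (𝓝 ((a + ∑' k, h k x) ^ (ENNReal.toReal 5))) :=
          (ENNReal.continuous_rpow_const.tendsto _).comp (hlim x)
        rw [h1.liminf_eq]
        gcongr
    _ ≤ liminf (fun n => ∫⁻ x, F n x ^ (ENNReal.toReal 5) ∂μ) atTop :=
        lintegral_liminf_le fun n => (hFm n).pow_const _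
    _ ≤ _ := by
        refine liminf_le_of_le (by isBoundedDefault) fun b hb => ?_
        obtain ⟨n, hn⟩ := hb.exists
        refine hn.trans ?_
        have := hF n
        rw [eLpNorm_eq_lintegral_rpow_enorm_toReal (by norm_num) (by norm_num), one_div,
          ENNReal.rpow_inv_le_iff (by norm_num)] at this
        exact this

/-- Telescoping over the scales bounds `|f x|` by its average at scale one plus the increments. The
first is controlled by the `L¹` norm of `f`, the others by a geometric series of `L⁵` norms. -/
theorem exists_eLpNorm_le_of_cone {Ω A : Set Vec} (hΩ : MeasurableSet Ω) (hfin : volume Ω ≠ ⊤)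
    (hA : MeasurableSet A) (hAΩ : A ⊆ Ω) {w₀ : Vec} {ρ : ℝ} (hρ : 0 < ρ)
    (hcone : ∀ x ∈ A, ∀ s ∈ Ioc (0 : ℝ) 1, ∀ w ∈ Metric.closedBall w₀ ρ, x + s • w ∈ Ω) :
    ∃ C : ENNReal, C ≠ ⊤ ∧ ∀ (f : Vec → ℝ) (g : Vec → Vec), MemLp f 2 (volume.restrict Ω) →
      StronglyMeasurable g → MemLp g 2 (volume.restrict Ω) →
      (∀ φ : Vec → ℝ, ContDiff ℝ ∞ φ → HasCompactSupport φ → tsupport φ ⊆ Ω → ∀ j : Fin 3,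
        ∫ x in Ω, f x * fderiv ℝ φ x (EuclideanSpace.single j 1) = - ∫ x in Ω, g x j * φ x) →
      eLpNorm f 5 (volume.restrict A) ≤
        C * (eLpNorm f 2 (volume.restrict Ω) + eLpNorm g 2 (volume.restrict Ω)) := by
  let β : ContDiffBump w₀ := ⟨ρ / 2, ρ, half_pos hρ, half_lt_self hρ⟩
  set κ : Vec → ℝ := β.normed volume
  have hκ : ContDiff ℝ ∞ κ := β.contDiff_normed
  have hc : HasCompactSupport κ := β.hasCompactSupport_normed
  have hint : ∫ z, κ z = 1 := β.integral_normed
  have hsupp : Function.support κ ⊆ Metric.closedBall w₀ ρ := by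
    rw [β.support_normed_eq]; exact Metric.ball_subset_closedBall
  obtain ⟨M, hM⟩ := hc.exists_bound_of_continuous hκ.continuous
  set R : ℝ := ‖w₀‖ + ρ
  have hR : 0 < R := by positivity
  have hsupp0 : Function.support κ ⊆ Metric.closedBall 0 R := by
    refine hsupp.trans (Metric.closedBall_subset_closedBall' ?_)
    rw [dist_zero_right, add_comm]
  have : IsFiniteMeasure (volume.restrict Ω) := ⟨by simpa using hfin.lt_top⟩
  have hAfin : volume A ≠ ⊤ := ((measure_mono hAΩ).trans_lt hfin.lt_top).ne
  set D := ((volume (Metric.closedBall (0 : Vec) R)) ^ (1 / 10 : ℝ)) ^ 7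
  set C₁ := ENNReal.ofReal (1024 ^ 3 * M * R)
  set C₂ := ENNReal.ofReal M * volume Ω ^ (1 / 2 : ℝ) * volume A ^ (1 / 5 : ℝ)
  have hD : D ≠ ⊤ := ENNReal.pow_ne_top
    (ENNReal.rpow_ne_top_of_nonneg (by norm_num) measure_closedBall_lt_top.ne)
  refine ⟨C₂ + C₁ * (D * 2), ?_, fun f g hf hgm hg hweak => ?_⟩
  · refine ENNReal.add_ne_top.2 ⟨ENNReal.mul_ne_top (ENNReal.mul_ne_top ENNReal.ofReal_ne_top
      (ENNReal.rpow_ne_top_of_nonneg (by norm_num) hfin))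
      (ENNReal.rpow_ne_top_of_nonneg (by norm_num) hAfin), ENNReal.mul_ne_top ENNReal.ofReal_ne_top
      (ENNReal.mul_ne_top hD (by norm_num))⟩
  have hfi : IntegrableOn f Ω := hf.integrable (by norm_num)
  have hgi : IntegrableOn g Ω := hg.integrable (by norm_num)
  set G : Vec → ENNReal := Ω.indicator (fun y => ‖g y‖ₑ) with hG
  have hGm : Measurable G := hgm.enorm.indicator hΩ
  have hGN : eLpNorm G 2 volume = eLpNorm g 2 (volume.restrict Ω) := by
    rw [hG, eLpNorm_indicator_eq_eLpNorm_restrict hΩ]; simp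
  set Nf := eLpNorm f 2 (volume.restrict Ω)
  set Ng := eLpNorm g 2 (volume.restrict Ω)
  have h1 : ∫⁻ y in Ω, ‖f y‖ₑ ≤ Nf * volume Ω ^ (1 / 2 : ℝ) := by
    have := eLpNorm_le_eLpNorm_mul_rpow_measure_univ (p := 1) (q := 2) (by norm_num) hf.1
    rw [eLpNorm_one_eq_lintegral_enorm] at this
    refine this.trans_eq ?_
    norm_num [Nf]
  set m : ℕ → Vec → ℝ := fun k x => ∫ y in Ω, coneKernel κ x (scale k) y * f y
  set h : ℕ → Vec → ENNReal := fun k x => C₁ * (ENNReal.ofReal ((scale k)⁻¹ ^ 2) *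
    ∫⁻ y in Metric.closedBall x (R * scale k), G y) with hh
  have hm0 (x : Vec) : ‖m 0 x‖ₑ ≤ ENNReal.ofReal M * (Nf * volume Ω ^ (1 / 2 : ℝ)) := by
    refine (enorm_integral_le_lintegral_enorm _).trans ?_
    refine le_trans ?_ (mul_le_mul_right h1 _)
    rw [← lintegral_const_mul' _ _ ENNReal.ofReal_ne_top]
    refine lintegral_mono fun y => ?_
    rw [enorm_mul]
    gcongr
    rw [← ofReal_norm]
    refine ENNReal.ofReal_le_ofReal ?_
    simpa [coneKernel, scale] using hM (y - x)
  have hmn (x : Vec) (hx : x ∈ A) (n : ℕ) :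
      ‖m n x‖ₑ ≤ ‖m 0 x‖ₑ + ∑ k ∈ Finset.range n, h k x := by
    induction n with
    | zero => simp
    | succ n ih =>
      have h2 := enorm_integral_coneKernel_sub_le hκ hc hρ.le hsupp hΩ hfi hgi hweak hM le_rfl
        (hcone x hx) n
      have h3 : m (n + 1) x = m n x + (m (n + 1) x - m n x) := by ring
      rw [h3, Finset.sum_range_succ, ← add_assoc]
      exact (enorm_add_le _ _).trans (add_le_add ih h2)
  have hfx : ∀ᵐ x ∂(volume.restrict A),
      ‖f x‖ₑ ≤ ENNReal.ofReal M * (Nf * volume Ω ^ (1 / 2 : ℝ)) + ∑' k, h k x := by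
    filter_upwards [ae_restrict_of_ae_restrict_of_subset hAΩ
      (ae_tendsto_integral_coneKernel hint hR hsupp0 hM hΩ hfi), ae_restrict_mem hA] with x hx hxA
    refine le_of_tendsto hx.enorm (Eventually.of_forall fun n => ?_)
    exact (hmn x hxA n).trans (add_le_add (hm0 x) (ENNReal.sum_le_tsum _))
  have hgeom : ∑' k : ℕ, ENNReal.ofReal ((1 / 2) ^ k) = 2 := by
    rw [← ENNReal.ofReal_tsum_of_nonneg (fun k => by positivity) summable_geometric_two,
      tsum_geometric_two]
    simp
  have hsum : ∑' k, eLpNorm (h k) 5 (volume.restrict A) ≤ C₁ * (D * 2) * Ng := by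
    have hk (k : ℕ) : eLpNorm (h k) 5 (volume.restrict A) ≤
        C₁ * (D * Ng) * ENNReal.ofReal ((1 / 2) ^ k) := by
      refine (eLpNorm_mono_measure _ Measure.restrict_le_self).trans ?_
      rw [hh, mul_assoc]
      refine (eLpNorm_le_mul_eLpNorm_of_ae_le_mul'' 5
        ((measurable_lintegral_closedBall hGm _).const_mul _).aestronglyMeasurable (Eventually.of_forall fun x => ?_)).trans
        (mul_le_mul_right
        (eLpNorm_scale_mul_lintegral_closedBall_le hGm hR.le k |>.trans_eq (by rw [hGN])) _)
      exact le_rfl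
    refine (ENNReal.tsum_le_tsum hk).trans_eq ?_
    rw [ENNReal.tsum_mul_left, hgeom]; ring
  refine (eLpNorm_le_of_tendsto_of_enorm_le (fun k => ((measurable_lintegral_closedBall hGm
    _).const_mul _).const_mul _) hfx hsum).trans ?_
  rw [Measure.restrict_apply_univ, mul_add, add_mul, add_mul]
  calc _ = C₂ * Nf + C₁ * (D * 2) * Ng := by simp only [C₂]; ring
    _ ≤ _ := by
      gcongr
      · exact le_self_add
      · exact le_add_self

/-! ### The cone condition and the Sobolev embedding -/

theorem IsBoundedLipschitzDomain.exists_cone {Ω : Set Vec} (hΩ : IsBoundedLipschitzDomain Ω)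
    {x₀ : Vec} (hx₀ : x₀ ∈ closure Ω) :
    ∃ U : Set Vec, IsOpen U ∧ x₀ ∈ U ∧ ∃ (w₀ : Vec) (ρ : ℝ), 0 < ρ ∧
      ∀ x ∈ U ∩ Ω, ∀ s ∈ Ioc (0 : ℝ) 1, ∀ w ∈ Metric.closedBall w₀ ρ, x + s • w ∈ Ω := by
  by_cases hx : x₀ ∈ Ω
  · obtain ⟨r, hr, hball⟩ := Metric.isOpen_iff.1 hΩ.isOpen x₀ hx
    refine ⟨Metric.ball x₀ (r / 2), Metric.isOpen_ball, Metric.mem_ball_self (by positivity), 0,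
      r / 4, by positivity, fun x hx s hs w hw => hball ?_⟩
    rw [mem_closedBall_zero_iff] at hw
    have h1 := mem_ball_iff_norm.1 hx.1
    rw [mem_ball_iff_norm, add_sub_right_comm]
    have h2 : ‖s • w‖ ≤ r / 4 := by
      rw [norm_smul, Real.norm_of_nonneg hs.1.le]
      nlinarith [norm_nonneg w, hs.2]
    have h3 := norm_add_le (x - x₀) (s • w)
    linarith
  · have hfr : x₀ ∈ frontier Ω := by
      rw [frontier, hΩ.isOpen.interior_eq]; exact ⟨hx₀, hx⟩
    obtain ⟨e, ψ, K, U, hψ, hU, hxU, hgraph⟩ := hΩ.exists_chart x₀ hfr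
    obtain ⟨r, hr, hball⟩ := Metric.isOpen_iff.1 hU x₀ hxU
    have hK : (0 : ℝ) ≤ K := K.2
    set a := r / 4
    have ha : 0 < a := by positivity
    -- With this opening, `K ρ < a - ρ`: along the cone the height rises by at least `s (a - ρ)`,
    -- the graph of `ψ` by at most `s K ρ`. The choice `a = r / 4` keeps the cone inside the chart.
    set ρ := a / (2 * (K + 1))
    have hρ : 0 < ρ := by positivity
    have hρa : ρ ≤ a := by
      rw [div_le_iff₀ (by positivity)]; nlinarith
    have hKρ : K * ρ < a - ρ := by
      have : (K + 1) * ρ = a / 2 := by simp only [ρ]; field_simp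
      nlinarith
    refine ⟨Metric.ball x₀ (r / 2), Metric.isOpen_ball, Metric.mem_ball_self (by positivity),
      e.symm (EuclideanSpace.single 2 a), ρ, hρ, fun x hx s hs w hw => ?_⟩
    rw [mem_closedBall_iff_norm, ← e.norm_map, map_sub, e.apply_symm_apply] at hw
    set z := e w - EuclideanSpace.single 2 a with hz
    have hew : e w = z + EuclideanSpace.single 2 a := by rw [hz]; abel
    have hwn : ‖w‖ ≤ r / 2 := by
      rw [← e.norm_map, hew]
      refine (norm_add_le _ _).trans ?_
      rw [PiLp.norm_single, Real.norm_of_nonneg ha.le]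
      simp only [a] at hρa ⊢
      linarith
    have h1 := mem_ball_iff_norm.1 hx.1
    have h2 : ‖s • w‖ ≤ r / 2 := by
      rw [norm_smul, Real.norm_of_nonneg hs.1.le]
      nlinarith [norm_nonneg w, hs.2]
    have hyU : x + s • w ∈ U := hball (by
      rw [mem_ball_iff_norm, add_sub_right_comm]
      have h3 := norm_add_le (x - x₀) (s • w)
      linarith)
    have hxU' : x ∈ U := hball (by rw [mem_ball_iff_norm]; linarith)
    rw [hgraph _ hyU]
    have hx2 := (hgraph _ hxU').1 hx.2
    have hlip := hψ.dist_le_mul !₂[e (x + s • w) 0, e (x + s • w) 1] !₂[e x 0, e x 1]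
    have hzc (i : Fin 3) : |z i| ≤ ‖z‖ := PiLp.norm_apply_le z i
    have hplane : dist !₂[e (x + s • w) 0, e (x + s • w) 1] !₂[e x 0, e x 1] ≤ s * ‖z‖ := by
      rw [EuclideanSpace.dist_eq]
      refine Real.sqrt_le_iff.2 ⟨by have := hs.1; positivity, ?_⟩
      have h4 : ‖z‖ ^ 2 = z 0 ^ 2 + z 1 ^ 2 + z 2 ^ 2 := by
        rw [EuclideanSpace.norm_sq_eq]; simp [Fin.sum_univ_three]
      simp only [map_add, map_smul, hew, Fin.sum_univ_two, Real.dist_eq, sq_abs]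
      simp
      simp only [mul_pow]
      rw [h4]
      nlinarith [sq_nonneg (s * z 2)]
    have hup : e (x + s • w) 2 = e x 2 + s * (z 2 + a) := by
      simp [hew, mul_add]
    have hz2 : -ρ ≤ z 2 := by linarith [neg_abs_le (z 2), hzc 2]
    have h5 := (abs_le.1 (Real.dist_eq _ _ ▸ hlip)).2
    have h6 : (K : ℝ) * dist !₂[e (x + s • w) 0, e (x + s • w) 1] !₂[e x 0, e x 1] ≤
        s * (K * ρ) := by
      calc _ ≤ (K : ℝ) * (s * ρ) := by
            gcongr; exact hplane.trans (mul_le_mul_of_nonneg_left hw hs.1.le)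
        _ = _ := by ring
    rw [hup]
    have h7 : s * (K * ρ) ≤ s * (z 2 + a) := by
      have := hs.1; gcongr; linarith
    linarith

theorem IsBoundedLipschitzDomain.volume_ne_top {Ω : Set Vec} (hΩ : IsBoundedLipschitzDomain Ω) :
    volume Ω ≠ ⊤ := hΩ.isBounded.measure_lt_top.ne

theorem eLpNorm_restrict_biUnion_le {ι : Type*} (s : Finset ι) (A : ι → Set Vec) (f : Vec → ℝ) :
    eLpNorm f 5 (volume.restrict (⋃ i ∈ s, A i)) ≤ ∑ i ∈ s, eLpNorm f 5 (volume.restrict (A i)) := by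
  classical
  induction s using Finset.induction_on with
  | empty => simp
  | insert i s hi ih =>
    rw [Finset.set_biUnion_insert, Finset.sum_insert hi]
    refine le_trans ?_ (add_le_add le_rfl ih)
    refine (eLpNorm_mono_measure f (Measure.restrict_union_le _ _)).trans ?_
    rw [eLpNorm_eq_lintegral_rpow_enorm_toReal (by norm_num) (by norm_num),
      eLpNorm_eq_lintegral_rpow_enorm_toReal (by norm_num) (by norm_num),
      eLpNorm_eq_lintegral_rpow_enorm_toReal (by norm_num) (by norm_num), lintegral_add_measure]
    exact ENNReal.rpow_add_le_add_rpow _ _ (by norm_num) (by norm_num)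

/-- The closure of `Ω` is compact, so finitely many neighbourhoods with a uniform cone cover it, and
the local estimates add up. -/
theorem IsBoundedLipschitzDomain.exists_eLpNorm_le {Ω : Set Vec}
    (hΩ : IsBoundedLipschitzDomain Ω) :
    ∃ C : ENNReal, C ≠ ⊤ ∧ ∀ (f : Vec → ℝ) (g : Vec → Vec), MemLp f 2 (volume.restrict Ω) →
      StronglyMeasurable g → MemLp g 2 (volume.restrict Ω) →
      (∀ φ : Vec → ℝ, ContDiff ℝ ∞ φ → HasCompactSupport φ → tsupport φ ⊆ Ω → ∀ j : Fin 3,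
        ∫ x in Ω, f x * fderiv ℝ φ x (EuclideanSpace.single j 1) = - ∫ x in Ω, g x j * φ x) →
      eLpNorm f 5 (volume.restrict Ω) ≤
        C * (eLpNorm f 2 (volume.restrict Ω) + eLpNorm g 2 (volume.restrict Ω)) := by
  choose! U hUo hxU w ρ hρ hcone using fun x₀ (hx₀ : x₀ ∈ closure Ω) => hΩ.exists_cone hx₀
  obtain ⟨t, ht⟩ := hΩ.isBounded.isCompact_closure.elim_nhds_subcover' (fun x _ => U x)
    (fun x hx => (hUo x hx).mem_nhds (hxU x hx))
  have hC (x : closure Ω) := exists_eLpNorm_le_of_cone (A := U x ∩ Ω) hΩ.isOpen.measurableSet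
    hΩ.volume_ne_top ((hUo x x.2).inter hΩ.isOpen).measurableSet inter_subset_right
    (hρ x x.2) (hcone x x.2)
  choose C hCtop hC using hC
  refine ⟨∑ x ∈ t, C x, ENNReal.sum_ne_top.2 fun x _ => hCtop x, fun f g hf hgm hg hweak => ?_⟩
  have hsub : Ω ⊆ ⋃ x ∈ t, (U x ∩ Ω) := fun y hy => by
    have hy' : y ∈ ⋃ x ∈ t, U (x : Vec) := ht (subset_closure hy)
    obtain ⟨x, hxt, hyx⟩ := mem_iUnion₂.1 hy'
    exact mem_iUnion₂.2 ⟨x, hxt, hyx, hy⟩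
  refine (eLpNorm_mono_measure f (Measure.restrict_mono hsub le_rfl)).trans
    ((eLpNorm_restrict_biUnion_le t _ f).trans ?_)
  rw [Finset.sum_mul]
  exact Finset.sum_le_sum fun x _ => hC x f g hf hgm hg hweak

/-- The Sobolev embedding of `H¹(Ω)` into `L⁵(Ω)`. -/
theorem IsBoundedLipschitzDomain.exists_eLpNorm_five_le {Ω : Set Vec}
    (hΩ : IsBoundedLipschitzDomain Ω) (ι : Type) [Fintype ι] :
    ∃ C : ENNReal, C ≠ ⊤ ∧ ∀ (u : L2 Ω ι) (G : L2 Ω (ι × Fin 3)), IsWeakGrad u G →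
      eLpNorm u 5 (volume.restrict Ω) ≤ C * (‖u‖ₑ + ‖G‖ₑ) := by
  obtain ⟨C, hC, h⟩ := hΩ.exists_eLpNorm_le
  -- The Euclidean norm is at most the sum of the absolute values of the components, and each
  -- component contributes one `C`.
  refine ⟨Fintype.card ι * C, ENNReal.mul_ne_top (by simp) hC, fun u G hG => ?_⟩
  have hcomp (i : ι) : eLpNorm (fun x => u x i) 5 (volume.restrict Ω) ≤ C * (‖u‖ₑ + ‖G‖ₑ) := by
    let L : EuclideanSpace ℝ (ι × Fin 3) →L[ℝ] Vec :=
      LinearMap.toContinuousLinearMap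
        { toFun := fun a => WithLp.toLp 2 fun j => a (i, j)
          map_add' := fun a b => by ext; simp
          map_smul' := fun c a => by ext; simp }
    have hL (a : EuclideanSpace ℝ (ι × Fin 3)) : ‖L a‖ ≤ ‖a‖ := by
      rw [EuclideanSpace.norm_eq, EuclideanSpace.norm_eq]
      refine Real.sqrt_le_sqrt ?_
      rw [Fintype.sum_prod_type]
      exact Finset.single_le_sum (f := fun i => ∑ j, ‖a (i, j)‖ ^ 2)
        (fun i _ => Finset.sum_nonneg fun j _ => by positivity) (Finset.mem_univ i)
    have hgm : StronglyMeasurable fun x => L (G x) :=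
      L.continuous.comp_stronglyMeasurable (Lp.stronglyMeasurable G)
    have hu : MemLp (fun x => u x i) 2 (volume.restrict Ω) :=
      (EuclideanSpace.proj i : EuclideanSpace ℝ ι →L[ℝ] ℝ).comp_memLp u
    refine (h (fun x => u x i) (fun x => L (G x)) hu hgm (L.comp_memLp G)
      fun φ h1 h2 h3 j => hG φ h1 h2 h3 i j).trans ?_
    gcongr
    · rw [Lp.enorm_def]
      exact eLpNorm_mono fun x => PiLp.norm_apply_le (u x) i
    · rw [Lp.enorm_def]
      exact eLpNorm_mono fun x => hL (G x)
  have hsum : eLpNorm u 5 (volume.restrict Ω) ≤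
      ∑ i, eLpNorm (fun x => u x i) 5 (volume.restrict Ω) := by
    calc eLpNorm u 5 (volume.restrict Ω)
        ≤ eLpNorm (∑ i, fun x => ‖u x i‖) 5 (volume.restrict Ω) := by
          refine eLpNorm_mono_real fun x => ?_
          simp only [Finset.sum_apply]
          rw [EuclideanSpace.norm_eq]
          exact Real.sqrt_le_iff.2 ⟨Finset.sum_nonneg fun i _ => norm_nonneg _,
            Finset.sum_sq_le_sq_sum_of_nonneg fun i _ => norm_nonneg _⟩
      _ ≤ ∑ i, eLpNorm (fun x => ‖u x i‖) 5 (volume.restrict Ω) := by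
          refine eLpNorm_sum_le (fun i _ => ?_) (by norm_num)
          have hu : MemLp (fun x => u x i) 2 (volume.restrict Ω) :=
            (EuclideanSpace.proj i : EuclideanSpace ℝ ι →L[ℝ] ℝ).comp_memLp u
          exact hu.1.norm
      _ = _ := by simp only [eLpNorm_norm]
  refine hsum.trans ((Finset.sum_le_sum fun i _ => hcomp i).trans_eq ?_)
  simp [mul_assoc]

/-! ### Weak gradients -/

theorem isWeakGrad_weakGrad {Ω : Set Vec} {ι : Type} [Fintype ι] {u : L2 Ω ι} (hu : MemH1 u) :
    IsWeakGrad u (weakGrad u) := by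
  rw [weakGrad, dif_pos hu]; exact hu.choose_spec

theorem IsWeakGrad.smul {Ω : Set Vec} {ι : Type} [Fintype ι] {u : L2 Ω ι}
    {G : L2 Ω (ι × Fin 3)} (h : IsWeakGrad u G) (c : ℝ) : IsWeakGrad (c • u) (c • G) := by
  intro φ h1 h2 h3 i j
  have hl : ∫ x in Ω, (c • u : L2 Ω ι) x i * fderiv ℝ φ x (EuclideanSpace.single j 1) =
      c * ∫ x in Ω, u x i * fderiv ℝ φ x (EuclideanSpace.single j 1) := by
    rw [← integral_const_mul]
    refine integral_congr_ae ?_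
    filter_upwards [Lp.coeFn_smul c u] with x hx
    rw [hx]; simp [mul_assoc]
  have hr : ∫ x in Ω, (c • G : L2 Ω (ι × Fin 3)) x (i, j) * φ x =
      c * ∫ x in Ω, G x (i, j) * φ x := by
    rw [← integral_const_mul]
    refine integral_congr_ae ?_
    filter_upwards [Lp.coeFn_smul c G] with x hx
    rw [hx]; simp [mul_assoc]
  rw [hl, hr, h φ h1 h2 h3 i j, mul_neg]

/-- The fundamental lemma of the calculus of variations, component by component. As `weakGrad` is a
mere choice, uniqueness is what makes it commute with scalars. -/
theorem IsWeakGrad.unique {Ω : Set Vec} (hΩ : IsOpen Ω) {ι : Type} [Fintype ι] {u : L2 Ω ι}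
    {G G' : L2 Ω (ι × Fin 3)} (h : IsWeakGrad u G) (h' : IsWeakGrad u G') : G = G' := by
  have hloc (F : L2 Ω (ι × Fin 3)) (p : ι × Fin 3) :
      LocallyIntegrable (fun x => F x p) (volume.restrict Ω) :=
    ((EuclideanSpace.proj p : EuclideanSpace ℝ (ι × Fin 3) →L[ℝ] ℝ).comp_memLp
      F).locallyIntegrable (by norm_num)
  have hkey (p : ι × Fin 3) : ∀ᵐ x ∂(volume.restrict Ω), x ∈ Ω → G x p - G' x p = 0 := by
    refine hΩ.ae_eq_zero_of_integral_contDiff_smul_eq_zero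
      (((hloc G p).sub (hloc G' p)).locallyIntegrableOn _) fun φ h1 h2 h3 => ?_
    have hi (F : L2 Ω (ι × Fin 3)) : Integrable (fun x => F x p * φ x) (volume.restrict Ω) := by
      have := (hloc F p).integrable_smul_left_of_hasCompactSupport h1.continuous h2
      simpa [mul_comm] using this
    have e1 := h φ h1 h2 h3 p.1 p.2
    have e2 := h' φ h1 h2 h3 p.1 p.2
    have e3 : ∫ x in Ω, φ x • (G x p - G' x p) =
        (∫ x in Ω, G x p * φ x) - ∫ x in Ω, G' x p * φ x := by
      rw [← integral_sub (hi G) (hi G')]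
      congr 1; ext x; simp only [smul_eq_mul]; ring
    rw [e3]
    simp only [Prod.mk.eta] at e1 e2
    linarith
  ext1
  filter_upwards [ae_all_iff.2 hkey, ae_restrict_mem hΩ.measurableSet] with x hx hxΩ
  ext p
  exact sub_eq_zero.1 (hx p hxΩ)

theorem MemH1.smul {Ω : Set Vec} {ι : Type} [Fintype ι] {u : L2 Ω ι} (hu : MemH1 u) (c : ℝ) :
    MemH1 (c • u) := ⟨_, (isWeakGrad_weakGrad hu).smul c⟩

theorem weakGrad_smul {Ω : Set Vec} (hΩ : IsOpen Ω) {ι : Type} [Fintype ι] {u : L2 Ω ι}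
    (hu : MemH1 u) (c : ℝ) : weakGrad (c • u) = c • weakGrad u :=
  (isWeakGrad_weakGrad (hu.smul c)).unique hΩ ((isWeakGrad_weakGrad hu).smul c)

theorem memH1_zero {Ω : Set Vec} {ι : Type} [Fintype ι] : MemH1 (0 : L2 Ω ι) := by
  refine ⟨0, fun φ h1 h2 h3 i j => ?_⟩
  have hl : ∫ x in Ω, (0 : L2 Ω ι) x i * fderiv ℝ φ x (EuclideanSpace.single j 1) = 0 := by
    refine integral_eq_zero_of_ae ?_
    filter_upwards [Lp.coeFn_zero (EuclideanSpace ℝ ι) 2 (volume.restrict Ω)] with x hx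
    rw [hx]; simp
  have hr : ∫ x in Ω, (0 : L2 Ω (ι × Fin 3)) x (i, j) * φ x = 0 := by
    refine integral_eq_zero_of_ae ?_
    filter_upwards [Lp.coeFn_zero (EuclideanSpace ℝ (ι × Fin 3)) 2 (volume.restrict Ω)] with x hx
    rw [hx]; simp
  rw [hl, hr, neg_zero]

/-! ### Trilinear terms -/

section Trilinear

variable {α : Type*} [MeasurableSpace α] {μ : Measure α}
  {E F H : Type*} [NormedAddCommGroup E] [NormedSpace ℝ E] [NormedAddCommGroup F] [NormedSpace ℝ F]
  [NormedAddCommGroup H] [InnerProductSpace ℝ H]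

/-- Hölder's inequality with `1/4 + 1/4 + 1/2 = 1`. -/
theorem eLpNorm_inner_bilin_le (B : E →L[ℝ] F →L[ℝ] H) {v : α → E} {G : α → F} {a : α → H}
    (hv : AEStronglyMeasurable v μ) (hG : AEStronglyMeasurable G μ)
    (ha : AEStronglyMeasurable a μ) :
    eLpNorm (fun x => (inner ℝ (B (v x) (G x)) (a x) : ℝ)) 1 μ ≤
      ‖B‖ₑ * (eLpNorm v 4 μ * eLpNorm a 4 μ) * eLpNorm G 2 μ := by
  have : ENNReal.HolderTriple 4 4 2 := ⟨by
    rw [← two_mul, show (4 : ENNReal) = 2 * 2 by norm_num,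
      ENNReal.mul_inv (by norm_num) (by norm_num), ← mul_assoc,
      ENNReal.mul_inv_cancel (by norm_num) (by norm_num), one_mul]⟩
  have h1 : eLpNorm (fun x => ‖v x‖ * ‖a x‖) 2 μ ≤ eLpNorm v 4 μ * eLpNorm a 4 μ := by
    have := eLpNorm_le_eLpNorm_mul_eLpNorm_of_nnnorm (p := 4) (q := 4) (r := 2) hv ha
      (fun e h => ‖e‖ * ‖h‖) 1 (Eventually.of_forall fun x => by simp)
    simpa using this
  have h2 := eLpNorm_le_eLpNorm_mul_eLpNorm_of_nnnorm (p := 2) (q := 2) (r := 1)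
    (hv.norm.mul ha.norm) hG (fun c g => c * ‖g‖) 1 (Eventually.of_forall fun x => by simp)
  have h3 : eLpNorm (fun x => (inner ℝ (B (v x) (G x)) (a x) : ℝ)) 1 μ ≤
      ‖B‖ₑ * eLpNorm (fun x => ‖v x‖ * ‖a x‖ * ‖G x‖) 1 μ := by
    have := eLpNorm_le_nnreal_smul_eLpNorm_of_ae_le_mul (c := ‖B‖₊)
      (f := fun x => (inner ℝ (B (v x) (G x)) (a x) : ℝ))
      (g := fun x => ‖v x‖ * ‖a x‖ * ‖G x‖) (μ := μ) (Eventually.of_forall fun x => by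
        rw [← NNReal.coe_le_coe]
        simp only [coe_nnnorm, NNReal.coe_mul, norm_mul, norm_norm]
        calc ‖(inner ℝ (B (v x) (G x)) (a x) : ℝ)‖ ≤ ‖B (v x) (G x)‖ * ‖a x‖ := norm_inner_le_norm _ _
          _ ≤ ‖B‖ * ‖v x‖ * ‖G x‖ * ‖a x‖ := by gcongr; exact B.le_opNorm₂ _ _
          _ = _ := by ring) 1
    simpa [ENNReal.smul_def, enorm_eq_nnnorm] using this
  refine h3.trans ?_
  rw [mul_assoc]
  gcongr
  refine h2.trans ?_
  rw [ENNReal.coe_one, one_mul]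
  exact mul_le_mul_left h1 _

/-- For bounded `a` the integral is a continuous function of the pair in `L² × L²`, hence measurable
in time. A general `a` is the limit of its truncations, with the full integrand as dominating
function. -/
theorem aestronglyMeasurable_integral_inner_bilin [CompleteSpace E] [CompleteSpace F]
    (B : E →L[ℝ] F →L[ℝ] H) {τ : Type*} [MeasurableSpace τ] {ν : Measure τ} {v : τ → Lp E 2 μ}
    {G : τ → Lp F 2 μ} (hv : AEStronglyMeasurable v ν) (hG : AEStronglyMeasurable G ν) {a : α → H}
    (ha : StronglyMeasurable a)
    (hint : ∀ᵐ t ∂ν, Integrable (fun x => (inner ℝ (B (v t x) (G t x)) (a x) : ℝ)) μ) :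
    AEStronglyMeasurable (fun t => ∫ x, (inner ℝ (B (v t x) (G t x)) (a x) : ℝ) ∂μ) ν := by
  set A : ℕ → α → H := fun n => {x | ‖a x‖ ≤ n}.indicator a with hA
  have hset (n : ℕ) : MeasurableSet {x | ‖a x‖ ≤ n} := ha.norm.measurable measurableSet_Iic
  have hAm (n : ℕ) : StronglyMeasurable (A n) := ha.indicator (hset n)
  have hAle (n : ℕ) (x : α) : ‖A n x‖ ≤ n := by
    by_cases hx : x ∈ {x | ‖a x‖ ≤ n}
    · rw [hA]; simp only [indicator_of_mem hx]; exact hx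
    · rw [hA]; simp [indicator_of_notMem hx]
  have hAL (n : ℕ) : MemLp (A n) ⊤ μ :=
    memLp_top_of_bound (hAm n).aestronglyMeasurable n (Eventually.of_forall (hAle n))
  have hmeas (n : ℕ) :
      AEStronglyMeasurable (fun t => ∫ x, (inner ℝ (B (v t x) (G t x)) (A n x) : ℝ) ∂μ) ν := by
    have hc : AEStronglyMeasurable (fun t => (innerSL ℝ : H →L[ℝ] H →L[ℝ] ℝ).lpPairing μ 1 ⊤
        (B.holderL μ 2 2 1 (v t) (G t)) ((hAL n).toLp (A n))) ν := by
      have h1 := (B.holderL μ 2 2 1).aestronglyMeasurable_comp₂ hv hG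
      exact (((innerSL ℝ : H →L[ℝ] H →L[ℝ] ℝ).lpPairing μ 1 ⊤).flip
        ((hAL n).toLp (A n))).continuous.comp_aestronglyMeasurable h1
    refine hc.congr (Eventually.of_forall fun t => ?_)
    simp only [ContinuousLinearMap.lpPairing_eq_integral]
    refine integral_congr_ae ?_
    filter_upwards [B.coeFn_holder (r := 1) (v t) (G t), (hAL n).coeFn_toLp] with x h1 h2
    have h1' : (B.holderL μ 2 2 1 (v t) (G t)) x = B (v t x) (G t x) := h1
    rw [h1', h2]; rfl
  refine aestronglyMeasurable_of_tendsto_ae atTop hmeas ?_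
  filter_upwards [hint] with t ht
  refine tendsto_integral_of_dominated_convergence
    (fun x => ‖(inner ℝ (B (v t x) (G t x)) (a x) : ℝ)‖) (fun n => ?_) ht.norm
    (fun n => Eventually.of_forall fun x => ?_) (Eventually.of_forall fun x => ?_)
  · exact (B.aestronglyMeasurable_comp₂ (Lp.aestronglyMeasurable _)
      (Lp.aestronglyMeasurable _)).inner (hAm n).aestronglyMeasurable
  · by_cases hx : x ∈ {x | ‖a x‖ ≤ n}
    · rw [hA]; simp only [indicator_of_mem hx]; exact le_rfl
    · rw [hA]; simp [indicator_of_notMem hx]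
  · refine tendsto_const_nhds.congr' ?_
    obtain ⟨N, hN⟩ := exists_nat_ge ‖a x‖
    filter_upwards [eventually_ge_atTop N] with n hn
    have hx : x ∈ {x | ‖a x‖ ≤ n} := hN.trans (by exact_mod_cast hn)
    rw [hA]; simp only [indicator_of_mem hx]

end Trilinear

theorem IsBoundedLipschitzDomain.exists_eLpNorm_four_le {Ω : Set Vec}
    (hΩ : IsBoundedLipschitzDomain Ω) (ι : Type) [Fintype ι] :
    ∃ C : ENNReal, C ≠ ⊤ ∧ ∀ u : L2 Ω ι, MemH1 u →
      eLpNorm u 4 (volume.restrict Ω) ≤ C * (‖u‖ₑ + ‖weakGrad u‖ₑ) := by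
  obtain ⟨C, hC, hsob⟩ := hΩ.exists_eLpNorm_five_le ι
  set M := volume Ω ^ (1 / (4 : ENNReal).toReal - 1 / (5 : ENNReal).toReal)
  have hM : M ≠ ⊤ := ENNReal.rpow_ne_top_of_nonneg (by norm_num) hΩ.volume_ne_top
  refine ⟨C * M, ENNReal.mul_ne_top hC hM, fun u hu => ?_⟩
  have := eLpNorm_le_eLpNorm_mul_rpow_measure_univ (p := 4) (q := 5) (by norm_num)
    (Lp.aestronglyMeasurable u)
  rw [Measure.restrict_apply_univ] at this
  refine this.trans ((mul_le_mul_left (hsob u _ (isWeakGrad_weakGrad hu)) M).trans_eq ?_)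
  ring

/-- At almost every time the space integral is at most a constant times `(‖u‖ + ‖∇u‖) ‖G‖`, a
product of two functions that are square-integrable in time. -/
theorem IsBoundedLipschitzDomain.integrable_integral_inner_bilin {Ω : Set Vec}
    (hΩ : IsBoundedLipschitzDomain Ω) {ι κ : Type} [Fintype ι] [Fintype κ] {H : Type*}
    [NormedAddCommGroup H] [InnerProductSpace ℝ H]
    (B : EuclideanSpace ℝ ι →L[ℝ] EuclideanSpace ℝ κ →L[ℝ] H) {ν : Measure ℝ}
    {u : ℝ → L2 Ω ι} {G : ℝ → L2 Ω κ} (hu1 : ∀ᵐ t ∂ν, MemH1 (u t)) (hu : MemLp u 2 ν)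
    (hDu : MemLp (fun t => weakGrad (u t)) 2 ν) (hG : MemLp G 2 ν) {a : Vec → H}
    (ha : StronglyMeasurable a) (ha4 : eLpNorm a 4 (volume.restrict Ω) ≠ ⊤) :
    (∀ᵐ t ∂ν, IntegrableOn (fun x => (inner ℝ (B (u t x) (G t x)) (a x) : ℝ)) Ω) ∧
      Integrable (fun t => ∫ x in Ω, (inner ℝ (B (u t x) (G t x)) (a x) : ℝ)) ν := by
  obtain ⟨C, hC, hsob⟩ := hΩ.exists_eLpNorm_four_le ι
  obtain ⟨K, hK⟩ : ∃ K, K = ‖B‖ₑ * (C * eLpNorm a 4 (volume.restrict Ω)) := ⟨_, rfl⟩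
  have hKtop : K ≠ ⊤ := hK ▸ ENNReal.mul_ne_top enorm_ne_top (ENNReal.mul_ne_top hC ha4)
  have hbound : ∀ᵐ t ∂ν, eLpNorm (fun x => (inner ℝ (B (u t x) (G t x)) (a x) : ℝ)) 1
      (volume.restrict Ω) ≤ K * (‖u t‖ₑ + ‖weakGrad (u t)‖ₑ) * ‖G t‖ₑ := by
    filter_upwards [hu1] with t ht
    refine (eLpNorm_inner_bilin_le B (Lp.aestronglyMeasurable _) (Lp.aestronglyMeasurable _)
      ha.aestronglyMeasurable).trans ?_
    rw [← Lp.enorm_def]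
    refine mul_le_mul_left ?_ _
    refine (mul_le_mul_right (mul_le_mul_left (hsob _ ht) _) _).trans_eq ?_
    rw [hK]; ring
  have hint : ∀ᵐ t ∂ν,
      IntegrableOn (fun x => (inner ℝ (B (u t x) (G t x)) (a x) : ℝ)) Ω := by
    filter_upwards [hbound] with t ht
    refine memLp_one_iff_integrable.1 ⟨(B.aestronglyMeasurable_comp₂ (Lp.aestronglyMeasurable _)
      (Lp.aestronglyMeasurable _)).inner ha.aestronglyMeasurable, ht.trans_lt ?_⟩
    have h1 : ‖u t‖ₑ ≠ ⊤ := enorm_ne_top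
    have h2 : ‖weakGrad (u t)‖ₑ ≠ ⊤ := enorm_ne_top
    have h3 : ‖G t‖ₑ ≠ ⊤ := enorm_ne_top
    finiteness
  refine ⟨hint, ?_⟩
  have hdom : Integrable (fun t => K.toReal * ((‖u t‖ + ‖weakGrad (u t)‖) * ‖G t‖)) ν :=
    ((hu.norm.add hDu.norm).integrable_mul hG.norm).const_mul _
  refine hdom.mono' (aestronglyMeasurable_integral_inner_bilin B hu.1 hG.1 ha hint) ?_
  filter_upwards [hbound] with t ht
  have h1 := (enorm_integral_le_lintegral_enorm
    (μ := volume.restrict Ω) (fun x => (inner ℝ (B (u t x) (G t x)) (a x) : ℝ)))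
  rw [← eLpNorm_one_eq_lintegral_enorm] at h1
  have h2 := h1.trans ht
  have h3 := ENNReal.toReal_mono (by
    have h1 : ‖u t‖ₑ ≠ ⊤ := enorm_ne_top
    have h2 : ‖weakGrad (u t)‖ₑ ≠ ⊤ := enorm_ne_top
    have h3 : ‖G t‖ₑ ≠ ⊤ := enorm_ne_top
    finiteness) h2
  rw [ENNReal.toReal_mul, ENNReal.toReal_mul, ENNReal.toReal_add enorm_ne_top enorm_ne_top] at h3
  simpa [toReal_enorm, mul_assoc] using h3

/-! ### The algebraic operations as continuous (bi)linear maps -/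

/-- `convect` as a continuous bilinear map. -/
noncomputable def convectL :
    Vec →L[ℝ] EuclideanSpace ℝ ((Fin 3 × Fin 3) × Fin 3) →L[ℝ] Ten :=
  (LinearMap.mk₂ ℝ convect
    (fun v v' G => by
      ext p; simp [convect, add_mul, Finset.sum_add_distrib])
    (fun c v G => by
      ext p; simp [convect, mul_assoc, Finset.mul_sum])
    (fun v G G' => by
      ext p; simp [convect, mul_add, Finset.sum_add_distrib])
    (fun c v G => by
      ext p; simp [convect, Finset.mul_sum, mul_left_comm])).toContinuousBilinearMap

@[simp] theorem convectL_apply (v : Vec) (G : EuclideanSpace ℝ ((Fin 3 × Fin 3) × Fin 3)) :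
    convectL v G = convect v G := rfl

/-- `(S, M) ↦ S W - W S`, with `W` the antisymmetric part of `M`, as a continuous bilinear map. -/
noncomputable def commutatorSkewL : Ten →L[ℝ] Ten →L[ℝ] Ten :=
  (LinearMap.mk₂ ℝ (fun S M => tensorCommutator S (skewPart M))
    (fun S S' M => by
      ext p
      simp only [tensorCommutator, skewPart, PiLp.add_apply, ← Finset.sum_add_distrib]
      exact Finset.sum_congr rfl fun j _ => by ring)
    (fun c S M => by
      ext p
      simp only [tensorCommutator, skewPart, PiLp.smul_apply, smul_eq_mul, Finset.mul_sum]
      exact Finset.sum_congr rfl fun j _ => by ring)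
    (fun S M M' => by
      ext p
      simp only [tensorCommutator, skewPart, PiLp.add_apply, ← Finset.sum_add_distrib]
      exact Finset.sum_congr rfl fun j _ => by ring)
    (fun c S M => by
      ext p
      simp only [tensorCommutator, skewPart, PiLp.smul_apply, smul_eq_mul, Finset.mul_sum]
      exact Finset.sum_congr rfl fun j _ => by ring)).toContinuousBilinearMap

@[simp] theorem commutatorSkewL_apply (S M : Ten) :
    commutatorSkewL S M = tensorCommutator S (skewPart M) := rfl

/-- `symPart` as a continuous linear map. -/
noncomputable def symPartL : Ten →L[ℝ] Ten :=
  LinearMap.toContinuousLinearMap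
    { toFun := symPart
      map_add' := fun M N => by
        ext p; simp only [symPart, PiLp.add_apply]; ring
      map_smul' := fun c M => by
        ext p; simp only [symPart, PiLp.smul_apply, smul_eq_mul, RingHom.id_apply]; ring }

@[simp] theorem symPartL_apply (M : Ten) : symPartL M = symPart M := rfl

/-! ### The ramp -/

/-- The function that vanishes up to the time `a` and grows with slope `δ⁻¹` from there on. -/
noncomputable def ramp (a δ t : ℝ) : ℝ := max 0 ((t - a) / δ)

/-- The weak derivative of `ramp a δ`. -/
noncomputable def rampDeriv (a δ : ℝ) : ℝ → ℝ := (Ioi a).indicator fun _ => δ⁻¹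

theorem continuous_ramp (a δ : ℝ) : Continuous (ramp a δ) := by
  unfold ramp; fun_prop

theorem ramp_nonneg (a δ t : ℝ) : 0 ≤ ramp a δ t := le_max_left _ _

theorem ramp_of_le {a δ t : ℝ} (hδ : 0 < δ) (ht : t ≤ a) : ramp a δ t = 0 :=
  max_eq_left (div_nonpos_of_nonpos_of_nonneg (by linarith) hδ.le)

theorem ramp_of_ge {a δ t : ℝ} (hδ : 0 < δ) (ht : a ≤ t) : ramp a δ t = (t - a) / δ :=
  max_eq_right (div_nonneg (by linarith) hδ.le)

/-- The ramp is not capped from above; none of its uses goes beyond the final time `a + δ`, where it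
reaches one. -/
theorem ramp_le_one {a δ t : ℝ} (hδ : 0 < δ) (ht : t ≤ a + δ) : ramp a δ t ≤ 1 :=
  max_le zero_le_one ((div_le_one hδ).2 (by linarith))

theorem measurable_rampDeriv (a δ : ℝ) : Measurable (rampDeriv a δ) :=
  measurable_const.indicator measurableSet_Ioi

theorem norm_rampDeriv_le {a δ : ℝ} (hδ : 0 < δ) (t : ℝ) : ‖rampDeriv a δ t‖ ≤ δ⁻¹ := by
  refine (norm_indicator_le_norm_self _ _).trans ?_
  rw [Real.norm_of_nonneg (by positivity)]

theorem setIntegral_Ioo_indicator_Ioi {X : Type*} [NormedAddCommGroup X] [NormedSpace ℝ X]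
    {a T' : ℝ} (ha : 0 ≤ a) (haT : a ≤ T') (h : ℝ → X) :
    ∫ t in Ioo 0 T', (Ioi a).indicator h t = ∫ t in a..T', h t := by
  rw [setIntegral_indicator measurableSet_Ioi, Ioo_inter_Ioi, max_eq_right ha,
    intervalIntegral.integral_of_le haT, integral_Ioc_eq_integral_Ioo]

theorem setIntegral_rampDeriv_smul {X : Type*} [NormedAddCommGroup X] [NormedSpace ℝ X]
    {a δ T' : ℝ} (ha : 0 ≤ a) (haT : a ≤ T') (h : ℝ → X) :
    ∫ t in Ioo 0 T', rampDeriv a δ t • h t = δ⁻¹ • ∫ t in a..T', h t := by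
  rw [← intervalIntegral.integral_smul, ← setIntegral_Ioo_indicator_Ioi ha haT]
  congr 1; ext t
  by_cases ht : t ∈ Ioi a <;> simp [rampDeriv, ht]

theorem setIntegral_rampDeriv_mul_ramp {a δ T' : ℝ} (ha : 0 ≤ a) (hδ : 0 < δ) (hT' : a + δ = T') :
    ∫ t in Ioo 0 T', rampDeriv a δ t * ramp a δ t = 1 / 2 := by
  have haT : a ≤ T' := by linarith
  have h1 := setIntegral_rampDeriv_smul (δ := δ) ha haT (ramp a δ)
  simp only [smul_eq_mul] at h1
  rw [h1]
  have h2 : ∫ t in a..T', ramp a δ t = ∫ t in a..T', (t - a) / δ := by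
    refine intervalIntegral.integral_congr fun t ht => ?_
    rw [uIcc_of_le haT] at ht
    exact ramp_of_ge hδ ht.1
  have h3 : ∫ t in a..T', (t - a) / δ = (T' - a) ^ 2 / (2 * δ) - (a - a) ^ 2 / (2 * δ) := by
    refine intervalIntegral.integral_eq_sub_of_hasDerivAt (f := fun t => (t - a) ^ 2 / (2 * δ))
      (fun t _ => ?_)
      (Continuous.intervalIntegrable (by fun_prop) _ _)
    refine ((((hasDerivAt_id t).sub_const a).fun_pow 2).div_const (2 * δ)).congr_deriv ?_
    simp; field_simp
  rw [h2, h3, ← hT']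
  field_simp
  ring

/-- Integration by parts on `(a, T')`: the boundary terms vanish because the ramp is zero at `a` and
`θ` at `T'`. -/
theorem setIntegral_deriv_mul_ramp {a δ T' : ℝ} (ha : 0 ≤ a) (hδ : 0 < δ) (hT' : a + δ = T')
    {θ : ℝ → ℝ} (hθ : ContDiff ℝ ∞ θ) (hθT : θ T' = 0) :
    ∫ t in Ioo 0 T', deriv θ t * ramp a δ t = - ∫ t in Ioo 0 T', θ t * rampDeriv a δ t := by
  have haT : a ≤ T' := by linarith
  have h1 := setIntegral_rampDeriv_smul (δ := δ) ha haT θ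
  have h2 : ∫ t in Ioo 0 T', deriv θ t * ramp a δ t = ∫ t in a..T', deriv θ t * ((t - a) / δ) := by
    rw [← setIntegral_Ioo_indicator_Ioi ha haT]
    congr 1; ext t
    by_cases ht : t ∈ Ioi a
    · rw [indicator_of_mem ht, ramp_of_ge hδ (le_of_lt ht)]
    · rw [indicator_of_notMem ht, ramp_of_le hδ (not_lt.1 ht), mul_zero]
  have hd : Continuous (deriv θ) := hθ.continuous_deriv (by simp)
  have hc := hθ.continuous
  have h3 : ∫ t in a..T', (deriv θ t * ((t - a) / δ) + θ t * (1 / δ)) =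
      θ T' * ((T' - a) / δ) - θ a * ((a - a) / δ) := by
    refine intervalIntegral.integral_eq_sub_of_hasDerivAt (f := fun t => θ t * ((t - a) / δ))
      (fun t _ => ?_) (Continuous.intervalIntegrable (by fun_prop) _ _)
    exact ((hθ.differentiable (by simp)) t).hasDerivAt.mul
      (((hasDerivAt_id t).sub_const a).div_const δ)
  rw [intervalIntegral.integral_add (Continuous.intervalIntegrable (by fun_prop) _ _)
    (Continuous.intervalIntegrable (by fun_prop) _ _), intervalIntegral.integral_mul_const, hθT] at h3
  simp only [smul_eq_mul] at h1
  rw [h2, show (fun t => θ t * rampDeriv a δ t) = fun t => rampDeriv a δ t * θ t by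
    ext t; ring, h1]
  rw [one_div] at h3
  simp at h3
  linarith

/-- Dominated convergence: on the interval the ramp is at most one, and at a given `t` it is zero
once `δ < T' - t`. -/
theorem tendsto_setIntegral_ramp_mul {T' : ℝ} {k : ℝ → ℝ} (hk : IntegrableOn k (Ioo 0 T')) :
    Tendsto (fun δ => ∫ t in Ioo 0 T', ramp (T' - δ) δ t * k t) (𝓝[>] 0) (𝓝 0) := by
  have : Tendsto (fun δ => ∫ t in Ioo 0 T', ramp (T' - δ) δ t * k t) (𝓝[>] 0)
      (𝓝 (∫ t in Ioo 0 T', (0 : ℝ))) := by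
    refine tendsto_integral_filter_of_dominated_convergence (fun t => ‖k t‖)
      (Eventually.of_forall fun δ => (continuous_ramp _ _).aestronglyMeasurable.mul hk.1) ?_ hk.norm
      ?_
    · filter_upwards [self_mem_nhdsWithin] with δ hδ
      filter_upwards [ae_restrict_mem measurableSet_Ioo] with t ht
      rw [norm_mul, Real.norm_of_nonneg (ramp_nonneg _ _ _)]
      exact mul_le_of_le_one_left (norm_nonneg _) (ramp_le_one hδ (by linarith [ht.2]))
    · filter_upwards [ae_restrict_mem measurableSet_Ioo] with t ht
      refine tendsto_const_nhds.congr' ?_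
      filter_upwards [self_mem_nhdsWithin,
        nhdsWithin_le_nhds (Iio_mem_nhds (sub_pos.2 ht.2))] with δ hδ hδ2
      rw [ramp_of_le hδ (by have : δ < T' - t := hδ2; linarith), zero_mul]
  simpa using this

theorem memL2H1_ramp {Ω : Set Vec} (hΩ : IsOpen Ω) {ι : Type} [Fintype ι] {A : L2 Ω ι}
    (hA : MemH1 A) {a δ T' : ℝ} (hδ : 0 < δ) (hT' : a + δ = T') :
    MemL2H1 T' (fun t => ramp a δ t • A) := by
  refine ⟨Eventually.of_forall fun t => hA.smul _, ?_⟩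
  have h : (fun t => weakGrad (ramp a δ t • A)) = fun t => ramp a δ t • weakGrad A :=
    funext fun t => weakGrad_smul hΩ hA _
  rw [h]
  refine MemLp.of_bound ((continuous_ramp a δ).aestronglyMeasurable.smul
    aestronglyMeasurable_const) (1 * ‖weakGrad A‖) ?_
  filter_upwards [ae_restrict_mem measurableSet_Ioo] with t ht
  rw [norm_smul, Real.norm_of_nonneg (ramp_nonneg _ _ _)]
  exact mul_le_mul_of_nonneg_right (ramp_le_one hδ (by linarith [ht.2])) (norm_nonneg _)

theorem lintegral_ramp_smul_pow_lt_top {Ω : Set Vec} {ι : Type} [Fintype ι] {A : L2 Ω ι}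
    (hA : eLpNorm A 5 (volume.restrict Ω) < ⊤) {a δ T' : ℝ} (hδ : 0 < δ) (hT' : a + δ = T') :
    ∫⁻ t in Ioo 0 T', ∫⁻ x in Ω, ‖(ramp a δ t • A : L2 Ω ι) x‖ₑ ^ 5 < ⊤ := by
  have h6 : ∫⁻ x in Ω, ‖A x‖ₑ ^ 5 < ⊤ := by
    have := lintegral_rpow_enorm_lt_top_of_eLpNorm_lt_top (by norm_num) (by norm_num) hA
    rw [ENNReal.toReal_ofNat] at this
    exact_mod_cast this
  calc ∫⁻ t in Ioo 0 T', ∫⁻ x in Ω, ‖(ramp a δ t • A : L2 Ω ι) x‖ₑ ^ 5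
      ≤ ∫⁻ t in Ioo 0 T', ∫⁻ x in Ω, ‖A x‖ₑ ^ 5 := by
        refine setLIntegral_mono' measurableSet_Ioo fun t ht => lintegral_mono_ae ?_
        filter_upwards [Lp.coeFn_smul (ramp a δ t) A] with x hx
        rw [hx, Pi.smul_apply, enorm_smul]
        refine pow_le_pow_left₀ zero_le (mul_le_of_le_one_left' ?_) 5
        rw [← ofReal_norm, Real.norm_of_nonneg (ramp_nonneg _ _ _)]
        exact ENNReal.ofReal_le_one.2 (ramp_le_one hδ (by linarith [ht.2]))
    _ < ⊤ := by
        rw [setLIntegral_const]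
        exact ENNReal.mul_lt_top h6 measure_Ioo_lt_top

theorem IsBoundedLipschitzDomain.eLpNorm_five_lt_top {Ω : Set Vec}
    (hΩ : IsBoundedLipschitzDomain Ω) {ι : Type} [Fintype ι] {A : L2 Ω ι} (hA : MemH1 A) :
    eLpNorm A 5 (volume.restrict Ω) < ⊤ := by
  obtain ⟨C, hC, hsob⟩ := hΩ.exists_eLpNorm_five_le ι
  exact (hsob _ _ (isWeakGrad_weakGrad hA)).trans_lt
    (ENNReal.mul_ne_top hC (ENNReal.add_ne_top.2 ⟨enorm_ne_top, enorm_ne_top⟩)).lt_top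

theorem memZ_ramp {Ω : Set Vec} (hΩ : IsBoundedLipschitzDomain Ω) {A : L2dev Ω}
    (hA : MemH1 (A : L2 Ω (Fin 3 × Fin 3))) {a δ T' : ℝ} (ha : 0 ≤ a) (hδ : 0 < δ)
    (hT' : a + δ = T') :
    MemZ T' (fun t => ramp a δ t • A) (fun t => rampDeriv a δ t • A) where
  continuousOn := ((continuous_ramp a δ).smul continuous_const).continuousOn
  memLp_deriv := by
    refine MemLp.of_bound ((measurable_rampDeriv a δ).aestronglyMeasurable.smul
      aestronglyMeasurable_const) (δ⁻¹ * ‖A‖) (Eventually.of_forall fun t => ?_)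
    rw [norm_smul]
    gcongr
    exact norm_rampDeriv_le hδ t
  weakDeriv := fun θ h1 h2 h3 => by
    have hθT : θ T' = 0 := image_eq_zero_of_notMem_tsupport fun h => (h3 h).2.false
    simp only [Submodule.coe_smul, smul_smul]
    rw [integral_smul_const, integral_smul_const, setIntegral_deriv_mul_ramp ha hδ hT' h1 hθT,
      neg_smul]
  memL2H1 := memL2H1_ramp hΩ.isOpen hA hδ hT'
  memL5 := lintegral_ramp_smul_pow_lt_top (hΩ.eLpNorm_five_lt_top hA) hδ hT'

/-- Convexity and `P 0 = 0` give `P (c • A) ≤ c P(A) ≤ P(A)` for `c` in `[0, 1]`, and the ramp is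
nonzero only on an interval of length `δ`. -/
theorem IsPotential.lintegral_ramp_le {Ω : Set Vec} {P : L2dev Ω → ENNReal} (hP : IsPotential P)
    (A : L2dev Ω) {a δ T' : ℝ} (hδ : 0 < δ) (hT' : a + δ = T') :
    ∫⁻ t in Ioo 0 T', P (ramp a δ t • A) ≤ ENNReal.ofReal δ * P A := by
  calc ∫⁻ t in Ioo 0 T', P (ramp a δ t • A)
      ≤ ∫⁻ t in Ioo 0 T', (Ioi a).indicator (fun _ => P A) t := by
        refine setLIntegral_mono' measurableSet_Ioo fun t ht => ?_
        by_cases hta : t ∈ Ioi a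
        · rw [indicator_of_mem hta]
          have h1 := ramp_le_one (a := a) hδ (by linarith [ht.2] : t ≤ a + δ)
          have := hP.convex A 0 (ramp a δ t) (ramp_nonneg _ _ _) h1
          rw [smul_zero, add_zero, hP.map_zero, mul_zero, add_zero] at this
          exact this.trans (mul_le_of_le_one_left' (ENNReal.ofReal_le_one.2 h1))
        · rw [indicator_of_notMem hta, ramp_of_le hδ (not_lt.1 hta), zero_smul, hP.map_zero]
    _ = P A * volume (Ioi a ∩ Ioo 0 T') := by
        rw [lintegral_indicator measurableSet_Ioi, lintegral_const,
          Measure.restrict_apply_univ, Measure.restrict_apply measurableSet_Ioi]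
    _ ≤ P A * volume (Ioo a T') := by
        gcongr
        exact fun t ht => ⟨ht.1, ht.2.2⟩
    _ = _ := by rw [Real.volume_Ioo, mul_comm, ← hT', add_sub_cancel_left]

/-! ### The space integrals of the variational inequality -/

theorem integrable_inner_sub {α E : Type*} [MeasurableSpace α] {μ : Measure α}
    [NormedAddCommGroup E] [InnerProductSpace ℝ E] (f g h : Lp E 2 μ) :
    Integrable (fun x => (inner ℝ (f x) (g x - h x) : ℝ)) μ := by
  refine (L2.integrable_inner (𝕜 := ℝ) f (g - h)).congr ?_
  filter_upwards [Lp.coeFn_sub g h] with x hx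
  rw [hx]; rfl

theorem integral_inner_sub {α E : Type*} [MeasurableSpace α] {μ : Measure α}
    [NormedAddCommGroup E] [InnerProductSpace ℝ E] (f g h : Lp E 2 μ) :
    ∫ x, (inner ℝ (f x) (g x - h x) : ℝ) ∂μ = inner ℝ f g - inner ℝ f h := by
  rw [← inner_sub_right, L2.inner_def]
  refine integral_congr_ae ?_
  filter_upwards [Lp.coeFn_sub g h] with x hx
  rw [hx]; rfl

/-- The field `D(v)` of symmetric gradients. -/
noncomputable def symGrad {Ω : Set Vec} (v : L2 Ω (Fin 3)) : L2 Ω (Fin 3 × Fin 3) :=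
  symPartL.compLpL 2 (volume.restrict Ω) (weakGrad v)

theorem coeFn_symGrad {Ω : Set Vec} (v : L2 Ω (Fin 3)) :
    symGrad v =ᵐ[volume.restrict Ω] fun x => symPart (weakGrad v x) :=
  symPartL.coeFn_compLp (weakGrad v)

theorem integral_mul_inner_symPart {Ω : Set Vec} (η : ℝ) (v : L2 Ω (Fin 3))
    (S : L2 Ω (Fin 3 × Fin 3)) :
    ∫ x in Ω, η * inner ℝ (symPart (weakGrad v x)) (S x) = η * inner ℝ (symGrad v) S := by
  rw [integral_const_mul, L2.inner_def]
  congr 1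
  refine integral_congr_ae ?_
  filter_upwards [coeFn_symGrad v] with x hx
  rw [hx]

/-- The terms `V · ∇S : A + (S W(V) - W(V) S) : A`, integrated over `Ω`. -/
noncomputable def transport {Ω : Set Vec} (v : L2 Ω (Fin 3)) (S A : L2 Ω (Fin 3 × Fin 3)) : ℝ :=
  (∫ x in Ω, inner ℝ (convectL (v x) (weakGrad S x)) (A x)) +
    ∫ x in Ω, inner ℝ (commutatorSkewL (S x) (weakGrad v x)) (A x)

theorem integral_dissipation_ramp {Ω : Set Vec} (hΩ : IsOpen Ω) (γ c d : ℝ)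
    (S A : L2 Ω (Fin 3 × Fin 3)) (hA : MemH1 A) :
    ∫ x in Ω, (inner ℝ ((d • A : L2 Ω (Fin 3 × Fin 3)) x)
        ((c • A : L2 Ω (Fin 3 × Fin 3)) x - S x) +
      γ * inner ℝ (weakGrad S x) (weakGrad (c • A) x - weakGrad S x)) =
    (d * c) * ‖A‖ ^ 2 - d * inner ℝ A S +
      (c * (γ * inner ℝ (weakGrad S) (weakGrad A)) - γ * ‖weakGrad S‖ ^ 2) := by
  rw [integral_add (integrable_inner_sub (d • A) (c • A) S)
    ((integrable_inner_sub (weakGrad S) (weakGrad (c • A)) (weakGrad S)).const_mul γ),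
    integral_const_mul, integral_inner_sub, integral_inner_sub, weakGrad_smul hΩ hA,
    real_inner_smul_left, real_inner_smul_left, real_inner_smul_right, real_inner_smul_right,
    real_inner_self_eq_norm_sq, real_inner_self_eq_norm_sq]
  ring

theorem integral_transport_ramp {Ω : Set Vec} (η c : ℝ) (v : L2 Ω (Fin 3))
    (S A : L2 Ω (Fin 3 × Fin 3))
    (h1 : IntegrableOn (fun x => (inner ℝ (convectL (v x) (weakGrad S x)) (A x) : ℝ)) Ω)
    (h2 : IntegrableOn (fun x => (inner ℝ (commutatorSkewL (S x) (weakGrad v x)) (A x) : ℝ)) Ω) :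
    ∫ x in Ω, (inner ℝ (convect (v x) (weakGrad S x)) ((c • A : L2 Ω (Fin 3 × Fin 3)) x)
        + inner ℝ (tensorCommutator (S x) (skewPart (weakGrad v x)))
            ((c • A : L2 Ω (Fin 3 × Fin 3)) x)
        - η * inner ℝ (symPart (weakGrad v x)) ((c • A : L2 Ω (Fin 3 × Fin 3)) x - S x)) =
    c * (transport v S A - η * inner ℝ (symGrad v) A) + η * inner ℝ (symGrad v) S := by
  have h3 := integrable_inner_sub (symGrad v) (c • A) S
  calc _ = ∫ x in Ω, (c * inner ℝ (convectL (v x) (weakGrad S x)) (A x)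
        + c * inner ℝ (commutatorSkewL (S x) (weakGrad v x)) (A x)
        - η * inner ℝ (symGrad v x) ((c • A : L2 Ω (Fin 3 × Fin 3)) x - S x)) := by
        refine integral_congr_ae ?_
        filter_upwards [Lp.coeFn_smul c A, coeFn_symGrad v] with x hx hx2
        rw [hx2, hx]
        simp only [Pi.smul_apply, real_inner_smul_right, convectL_apply, commutatorSkewL_apply]
    _ = _ := by
        rw [integral_sub ((h1.const_mul c).fun_add (h2.const_mul c)) (h3.const_mul η),
          integral_add (h1.const_mul c) (h2.const_mul c), integral_const_mul, integral_const_mul,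
          integral_const_mul, integral_inner_sub, real_inner_smul_right, transport]
        ring

/-! ### Integrability in time and the inequality tested with a ramp -/

section Regularity

variable {Ω : Set Vec} {T' : ℝ} {V : ℝ → L2 Ω (Fin 3)} {S : ℝ → L2dev Ω}

theorem MemX.memLp_coe (hS : MemX T' S) :
    MemLp (fun t => (S t : L2 Ω (Fin 3 × Fin 3))) 2 (volume.restrict (Ioo 0 T')) := by
  have : MemLp S 2 (volume.restrict (Ioo 0 T')) := hS.memLp.mono_exponent le_top
  exact (L2dev Ω).subtypeL.comp_memLp' this

theorem MemLH.memLp_symGrad (hV : MemLH T' V) :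
    MemLp (fun t => symGrad (V t)) 2 (volume.restrict (Ioo 0 T')) :=
  (symPartL.compLpL 2 (volume.restrict Ω)).comp_memLp' hV.memL2H1.2

theorem integrable_inner_of_memLp {α E : Type*} [MeasurableSpace α] {μ : Measure α}
    [NormedAddCommGroup E] [InnerProductSpace ℝ E] {f g : α → E} (hf : MemLp f 2 μ)
    (hg : MemLp g 2 μ) : Integrable (fun t => (inner ℝ (f t) (g t) : ℝ)) μ := by
  refine (hf.norm.integrable_mul hg.norm).mono' (hf.1.inner hg.1) (Eventually.of_forall fun t => ?_)
  exact norm_inner_le_norm _ _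

theorem integrable_transport (hΩ : IsBoundedLipschitzDomain Ω) (hV : MemLH T' V) (hS : MemX T' S)
    {A : L2 Ω (Fin 3 × Fin 3)} (hA : MemH1 A) :
    (∀ᵐ t ∂(volume.restrict (Ioo 0 T')),
      IntegrableOn (fun x => (inner ℝ (convectL (V t x)
        (weakGrad (S t : L2 Ω (Fin 3 × Fin 3)) x)) (A x) : ℝ)) Ω ∧
      IntegrableOn (fun x => (inner ℝ (commutatorSkewL ((S t : L2 Ω (Fin 3 × Fin 3)) x)
        (weakGrad (V t) x)) (A x) : ℝ)) Ω) ∧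
    IntegrableOn (fun t => transport (V t) (S t : L2 Ω (Fin 3 × Fin 3)) A) (Ioo 0 T') := by
  obtain ⟨C, hC, hsob⟩ := hΩ.exists_eLpNorm_four_le (Fin 3 × Fin 3)
  have h4 : eLpNorm A 4 (volume.restrict Ω) ≠ ⊤ :=
    ne_top_of_le_ne_top (ENNReal.mul_ne_top hC
      (ENNReal.add_ne_top.2 ⟨enorm_ne_top, enorm_ne_top⟩)) (hsob A hA)
  have hV2 : MemLp V 2 (volume.restrict (Ioo 0 T')) := hV.memLp.mono_exponent le_top
  have h1 := hΩ.integrable_integral_inner_bilin convectL hV.memL2H1.1 hV2 hV.memL2H1.2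
    hS.memL2H1.2 (Lp.stronglyMeasurable A) h4
  have h2 := hΩ.integrable_integral_inner_bilin commutatorSkewL hS.memL2H1.1 hS.memLp_coe
    hS.memL2H1.2 hV.memL2H1.2 (Lp.stronglyMeasurable A) h4
  exact ⟨h1.1.and h2.1, h1.2.add h2.2⟩

/-- The factor of `ramp` in the variational inequality tested with `ramp • A`. -/
noncomputable def rampRemainder (η γ : ℝ) (V : ℝ → L2 Ω (Fin 3)) (S : ℝ → L2dev Ω)
    (A : L2 Ω (Fin 3 × Fin 3)) (t : ℝ) : ℝ :=
  γ * inner ℝ (weakGrad (S t : L2 Ω (Fin 3 × Fin 3))) (weakGrad A) +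
    (transport (V t) (S t : L2 Ω (Fin 3 × Fin 3)) A - η * inner ℝ (symGrad (V t)) A)

theorem integrable_rampRemainder (hΩ : IsBoundedLipschitzDomain Ω) (η γ : ℝ) (hV : MemLH T' V)
    (hS : MemX T' S) {A : L2 Ω (Fin 3 × Fin 3)} (hA : MemH1 A) :
    IntegrableOn (rampRemainder η γ V S A) (Ioo 0 T') := by
  have h1 := integrable_inner_of_memLp hS.memL2H1.2 (memLp_const (weakGrad A))
  have h2 := integrable_inner_of_memLp hV.memLp_symGrad (memLp_const A)
  exact (h1.const_mul γ).add ((integrable_transport hΩ hV hS hA).2.sub (h2.const_mul η))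

theorem integrable_ramp_mul {a δ : ℝ} (hδ : 0 < δ) (hT' : a + δ = T') {k : ℝ → ℝ}
    (hk : IntegrableOn k (Ioo 0 T')) : IntegrableOn (fun t => ramp a δ t * k t) (Ioo 0 T') := by
  refine hk.bdd_mul (c := 1) (continuous_ramp _ _).aestronglyMeasurable ?_
  filter_upwards [ae_restrict_mem measurableSet_Ioo] with t ht
  rw [Real.norm_of_nonneg (ramp_nonneg _ _ _)]
  exact ramp_le_one hδ (by linarith [ht.2])

/-- Only the potential of the test function is estimated; all other terms are computed exactly and
sorted by whether they contain the derivative of the ramp, the ramp itself, or neither. The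
coefficient of `‖A‖²` is the integral of `rampDeriv * ramp`, which is `1 / 2`. -/
theorem VariationalIneq.lintegral_potential_le_of_ramp (hΩ : IsBoundedLipschitzDomain Ω) {η γ : ℝ}
    {P : L2dev Ω → ENNReal} (hP : IsPotential P) {S₀ : L2dev Ω} (hV : MemLH T' V) (hS : MemX T' S)
    {A : L2dev Ω} (hA : MemH1 (A : L2 Ω (Fin 3 × Fin 3))) {a δ : ℝ} (ha : 0 ≤ a) (hδ : 0 < δ)
    (hT' : a + δ = T')
    (hvar : VariationalIneq η γ P S₀ V S T' (fun t => ramp a δ t • A)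
      (fun t => rampDeriv a δ t • A)) :
    ((∫⁻ t in Ioo 0 T', P (S t) : ENNReal) : EReal) ≤
      ((ENNReal.ofReal δ * P A : ENNReal) : EReal) +
      ((1 / 2 * ‖A‖ ^ 2
        - inner ℝ (A : L2 Ω (Fin 3 × Fin 3))
          (δ⁻¹ • ∫ t in a..T', (S t : L2 Ω (Fin 3 × Fin 3)))
        + (∫ t in Ioo 0 T', ramp a δ t * rampRemainder η γ V S A t)
        - γ * (∫ t in Ioo 0 T', ‖weakGrad (S t : L2 Ω (Fin 3 × Fin 3))‖ ^ 2)
        + (∫ t in Ioo 0 T', η * inner ℝ (symGrad (V t)) (S t : L2 Ω (Fin 3 × Fin 3)))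
        + 1 / 2 * ‖S₀‖ ^ 2 : ℝ) : EReal) := by
  unfold VariationalIneq at hvar
  refine hvar.trans (add_le_add
    (EReal.coe_ennreal_le_coe_ennreal_iff.2 (hP.lintegral_ramp_le A hδ hT')) ?_)
  refine EReal.coe_le_coe_iff.2 (le_of_eq ?_)
  have haT : a ≤ T' := by linarith
  have hI1 := integrable_inner_of_memLp (memLp_const (A : L2 Ω (Fin 3 × Fin 3))) hS.memLp_coe
  have hI2 : IntegrableOn (fun t => γ * inner ℝ (weakGrad (S t : L2 Ω (Fin 3 × Fin 3)))
      (weakGrad (A : L2 Ω (Fin 3 × Fin 3)))) (Ioo 0 T') :=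
    (integrable_inner_of_memLp hS.memL2H1.2
      (memLp_const (weakGrad (A : L2 Ω (Fin 3 × Fin 3))))).const_mul γ
  have hI3 : Integrable (fun t => γ * ‖weakGrad (S t : L2 Ω (Fin 3 × Fin 3))‖ ^ 2)
      (volume.restrict (Ioo 0 T')) :=
    (hS.memL2H1.2.integrable_norm_pow (by norm_num)).const_mul γ
  have hI4 : IntegrableOn (fun t => transport (V t) (S t : L2 Ω (Fin 3 × Fin 3)) A -
      η * inner ℝ (symGrad (V t)) (A : L2 Ω (Fin 3 × Fin 3))) (Ioo 0 T') :=
    (integrable_transport hΩ hV hS hA).2.sub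
    ((integrable_inner_of_memLp hV.memLp_symGrad
      (memLp_const (A : L2 Ω (Fin 3 × Fin 3)))).const_mul η)
  have hI5 := (integrable_inner_of_memLp hV.memLp_symGrad hS.memLp_coe).const_mul η
  have hI6 : IntegrableOn (fun t => rampDeriv a δ t * ramp a δ t) (Ioo 0 T') := by
    refine (integrable_const (1 : ℝ)).bdd_mul (c := δ⁻¹)
      (measurable_rampDeriv a δ).aestronglyMeasurable
      (Eventually.of_forall (norm_rampDeriv_le hδ)) |> integrable_ramp_mul hδ hT' |>.congr ?_
    exact Eventually.of_forall fun t => by simp only; ring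
  have hI7 : IntegrableOn (fun t => rampDeriv a δ t *
      inner ℝ (A : L2 Ω (Fin 3 × Fin 3)) (S t : L2 Ω (Fin 3 × Fin 3))) (Ioo 0 T') :=
    hI1.bdd_mul (c := δ⁻¹) (measurable_rampDeriv a δ).aestronglyMeasurable
      (Eventually.of_forall (norm_rampDeriv_le hδ))
  have e1 : ∫ t in Ioo 0 T', ∫ x in Ω,
      (inner ℝ (((rampDeriv a δ t • A : L2dev Ω) : L2 Ω (Fin 3 × Fin 3)) x)
          (((ramp a δ t • A : L2dev Ω) : L2 Ω (Fin 3 × Fin 3)) x -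
            (S t : L2 Ω (Fin 3 × Fin 3)) x)
        + γ * inner ℝ (weakGrad (S t : L2 Ω (Fin 3 × Fin 3)) x)
          (weakGrad ((ramp a δ t • A : L2dev Ω) : L2 Ω (Fin 3 × Fin 3)) x -
            weakGrad (S t : L2 Ω (Fin 3 × Fin 3)) x)) =
      1 / 2 * ‖A‖ ^ 2 - inner ℝ (A : L2 Ω (Fin 3 × Fin 3))
          (δ⁻¹ • ∫ t in a..T', (S t : L2 Ω (Fin 3 × Fin 3)))
        + ((∫ t in Ioo 0 T', ramp a δ t * (γ * inner ℝ (weakGrad (S t : L2 Ω (Fin 3 × Fin 3)))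
            (weakGrad (A : L2 Ω (Fin 3 × Fin 3)))))
        - γ * ∫ t in Ioo 0 T', ‖weakGrad (S t : L2 Ω (Fin 3 × Fin 3))‖ ^ 2) := by
    have h0 (t : ℝ) := integral_dissipation_ramp hΩ.isOpen γ (ramp a δ t) (rampDeriv a δ t)
      (S t : L2 Ω (Fin 3 × Fin 3)) (A : L2 Ω (Fin 3 × Fin 3)) hA
    simp only [Submodule.coe_smul, h0]
    have hI8 := hI6.mul_const (‖(A : L2 Ω (Fin 3 × Fin 3))‖ ^ 2)
    have hI9 : IntegrableOn (fun t => rampDeriv a δ t * ramp a δ t *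
        ‖(A : L2 Ω (Fin 3 × Fin 3))‖ ^ 2 -
        rampDeriv a δ t * inner ℝ (A : L2 Ω (Fin 3 × Fin 3)) (S t : L2 Ω (Fin 3 × Fin 3)))
        (Ioo 0 T') := hI8.sub hI7
    have hI10 : IntegrableOn (fun t => ramp a δ t * (γ * inner ℝ
        (weakGrad (S t : L2 Ω (Fin 3 × Fin 3))) (weakGrad (A : L2 Ω (Fin 3 × Fin 3)))) -
        γ * ‖weakGrad (S t : L2 Ω (Fin 3 × Fin 3))‖ ^ 2) (Ioo 0 T') :=
      (integrable_ramp_mul hδ hT' hI2).sub hI3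
    rw [integral_add hI9 hI10, integral_sub hI8 hI7, integral_sub (integrable_ramp_mul hδ hT' hI2) hI3,
      integral_mul_const, setIntegral_rampDeriv_mul_ramp ha hδ hT', integral_const_mul]
    have h1 := setIntegral_rampDeriv_smul (δ := δ) ha haT
      (fun t => (inner ℝ (A : L2 Ω (Fin 3 × Fin 3)) (S t : L2 Ω (Fin 3 × Fin 3)) : ℝ))
    simp only [smul_eq_mul] at h1
    have hSi : IntervalIntegrable (fun t => (S t : L2 Ω (Fin 3 × Fin 3))) volume a T' := by
      rw [intervalIntegrable_iff_integrableOn_Ioo_of_le haT]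
      exact IntegrableOn.mono_set (hS.memLp_coe.integrable (by norm_num)) (Ioo_subset_Ioo_left ha)
    -- The inner product is pulled out of the time integral, which leaves the Bochner mean of `S`.
    -- Its limit does not involve `A`, so `A` may later depend on `T'`.
    have h2 := (innerSL ℝ (A : L2 Ω (Fin 3 × Fin 3))).intervalIntegral_comp_comm hSi
    simp only [innerSL_apply_apply] at h2
    rw [h1, h2, real_inner_smul_right]
    simp only [Submodule.coe_norm]
  have e2 : ∫ t in Ioo 0 T', ∫ x in Ω,
      (inner ℝ (convect (V t x) (weakGrad (S t : L2 Ω (Fin 3 × Fin 3)) x))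
          (((ramp a δ t • A : L2dev Ω) : L2 Ω (Fin 3 × Fin 3)) x)
        + inner ℝ (tensorCommutator ((S t : L2 Ω (Fin 3 × Fin 3)) x) (skewPart (weakGrad (V t) x)))
          (((ramp a δ t • A : L2dev Ω) : L2 Ω (Fin 3 × Fin 3)) x)
        - η * inner ℝ (symPart (weakGrad (V t) x))
          (((ramp a δ t • A : L2dev Ω) : L2 Ω (Fin 3 × Fin 3)) x -
            (S t : L2 Ω (Fin 3 × Fin 3)) x)) =
      (∫ t in Ioo 0 T', ramp a δ t * (transport (V t) (S t : L2 Ω (Fin 3 × Fin 3)) A -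
        η * inner ℝ (symGrad (V t)) (A : L2 Ω (Fin 3 × Fin 3)))) +
      ∫ t in Ioo 0 T', η * inner ℝ (symGrad (V t)) (S t : L2 Ω (Fin 3 × Fin 3)) := by
    rw [← integral_add (integrable_ramp_mul hδ hT' hI4) hI5]
    refine integral_congr_ae ?_
    filter_upwards [(integrable_transport hΩ hV hS hA).1] with t ht
    exact integral_transport_ramp η (ramp a δ t) (V t) (S t : L2 Ω (Fin 3 × Fin 3))
      (A : L2 Ω (Fin 3 × Fin 3)) ht.1 ht.2
  have e3 : ∫ t in Ioo 0 T', ramp a δ t * rampRemainder η γ V S A t =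
      (∫ t in Ioo 0 T', ramp a δ t * (γ * inner ℝ (weakGrad (S t : L2 Ω (Fin 3 × Fin 3)))
            (weakGrad (A : L2 Ω (Fin 3 × Fin 3))))) +
      ∫ t in Ioo 0 T', ramp a δ t * (transport (V t) (S t : L2 Ω (Fin 3 × Fin 3)) A -
        η * inner ℝ (symGrad (V t)) (A : L2 Ω (Fin 3 × Fin 3))) := by
    rw [← integral_add (integrable_ramp_mul hδ hT' hI2) (integrable_ramp_mul hδ hT' hI4)]
    congr 1; ext t
    rw [rampRemainder]; ring
  have e4 : ‖ramp a δ 0 • A - S₀‖ = ‖S₀‖ := by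
    rw [ramp_of_le hδ ha, zero_smul, zero_sub, norm_neg]
  rw [e1, e2, e3, e4]
  ring

end Regularity

/-- The mean over `(T' - δ, T')` is the left difference quotient of the primitive. -/
theorem tendsto_inv_smul_intervalIntegral_left {X : Type*} [NormedAddCommGroup X] [NormedSpace ℝ X]
    {f : ℝ → X} {T' : ℝ} (hT' : 0 < T') (hf : IntervalIntegrable f volume 0 T') {c : X}
    (h : HasDerivAt (fun x => ∫ t in (0 : ℝ)..x, f t) c T') :
    Tendsto (fun δ => δ⁻¹ • ∫ t in (T' - δ)..T', f t) (𝓝[>] 0) (𝓝 c) := by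
  have h1 : Tendsto (fun δ : ℝ => -δ) (𝓝[>] 0) (𝓝[<] 0) := by
    simpa using tendsto_neg_nhdsGT (a := (0 : ℝ))
  refine (h.tendsto_slope_zero_left.comp h1).congr' ?_
  filter_upwards [Ioo_mem_nhdsGT hT'] with δ hδ
  have h2 : IntervalIntegrable f volume 0 (T' - δ) :=
    hf.mono_set (by
      rw [uIcc_of_le (by linarith [hδ.2]), uIcc_of_le hT'.le]
      exact Icc_subset_Icc_right (by linarith [hδ.1]))
  simp only [Function.comp, ← sub_eq_add_neg]
  rw [← intervalIntegral.integral_interval_sub_left hf h2, inv_neg, neg_smul, ← smul_neg, neg_sub]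

/-! ### The energy inequality at a fixed time -/

section Energy

variable {Ω : Set Vec} {T' : ℝ} {V : ℝ → L2 Ω (Fin 3)} {S : ℝ → L2dev Ω} {η γ : ℝ}
  {P : L2dev Ω → ENNReal} {S₀ : L2dev Ω}

/-- The test function zero, written as a ramp times `A = 0`, has zero potential, so the upper bound
is a real number. -/
theorem lintegral_potential_ne_top (hΩ : IsBoundedLipschitzDomain Ω) (hP : IsPotential P)
    (hT' : 0 < T') (hV : MemLH T' V) (hS : MemX T' S)
    (hvar : ∀ R dR : ℝ → L2dev Ω, MemZ T' R dR → VariationalIneq η γ P S₀ V S T' R dR) :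
    ∫⁻ t in Ioo 0 T', P (S t) ≠ ⊤ := by
  have hA : MemH1 ((0 : L2dev Ω) : L2 Ω (Fin 3 × Fin 3)) := memH1_zero
  have h := (hvar _ _ (memZ_ramp hΩ hA le_rfl hT' (zero_add T'))).lintegral_potential_le_of_ramp hΩ
    hP hV hS hA le_rfl hT' (zero_add T')
  rw [hP.map_zero, mul_zero, EReal.coe_ennreal_zero, zero_add] at h
  intro htop
  rw [htop, EReal.coe_ennreal_top, top_le_iff] at h
  exact EReal.coe_ne_top _ h

theorem ae_potential_lt_top (hP : IsPotential P) (hS : MemX T' S)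
    (hfin : ∫⁻ t in Ioo 0 T', P (S t) ≠ ⊤) :
    ∀ᵐ t ∂(volume.restrict (Ioo 0 T')), P (S t) < ⊤ := by
  let _ : MeasurableSpace (L2dev Ω) := borel _
  have : BorelSpace (L2dev Ω) := ⟨rfl⟩
  -- Lower semicontinuity makes `P` Borel measurable, so a finite integral forces finite values
  -- almost everywhere.
  exact ae_lt_top' (hP.lowerSemicontinuous.measurable.comp_aemeasurable
    hS.memLp.aestronglyMeasurable.aemeasurable) hfin

/-- The choice `A = S T'` and the limit `δ → 0`. Differentiability of the primitive sends the mean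
of `S` to `S T'`, so `½ ‖S T'‖² - ‖S T'‖²` remains and moves to the left with the right sign.
Finiteness of `P (S T')` makes `δ P (S T')` vanish. -/
theorem energy_inequality_at (hΩ : IsBoundedLipschitzDomain Ω) (hP : IsPotential P)
    (hT' : 0 < T') (hV : MemLH T' V) (hS : MemX T' S)
    (hvar : ∀ R dR : ℝ → L2dev Ω, MemZ T' R dR → VariationalIneq η γ P S₀ V S T' R dR)
    (hA : MemH1 (S T' : L2 Ω (Fin 3 × Fin 3))) (hPA : P (S T') < ⊤)
    (hder : HasDerivAt (fun x => ∫ t in (0 : ℝ)..x, (S t : L2 Ω (Fin 3 × Fin 3)))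
      (S T' : L2 Ω (Fin 3 × Fin 3)) T') :
    ((1 / 2 * ‖S T'‖ ^ 2
        + γ * ∫ t in Ioo 0 T', ‖weakGrad (S t : L2 Ω (Fin 3 × Fin 3))‖ ^ 2 : ℝ) : EReal)
      + ((∫⁻ t in Ioo 0 T', P (S t) : ENNReal) : EReal) ≤
    ((1 / 2 * ‖S₀‖ ^ 2
        + ∫ t in Ioo 0 T', ∫ x in Ω, η * inner ℝ (symPart (weakGrad (V t) x))
            ((S t : L2 Ω (Fin 3 × Fin 3)) x) : ℝ) : EReal) := by
  simp only [integral_mul_inner_symPart]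
  set I := ∫ t in Ioo 0 T', ‖weakGrad (S t : L2 Ω (Fin 3 × Fin 3))‖ ^ 2
  set D := ∫ t in Ioo 0 T', η * inner ℝ (symGrad (V t)) (S t : L2 Ω (Fin 3 × Fin 3))
  have hSi : IntervalIntegrable (fun t => (S t : L2 Ω (Fin 3 × Fin 3))) volume 0 T' := by
    rw [intervalIntegrable_iff_integrableOn_Ioo_of_le hT'.le]
    exact hS.memLp_coe.integrable (by norm_num)
  set r : ℝ → ℝ := fun δ => δ * (P (S T')).toReal + (1 / 2 * ‖S T'‖ ^ 2
        - inner ℝ (S T' : L2 Ω (Fin 3 × Fin 3))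
          (δ⁻¹ • ∫ t in (T' - δ)..T', (S t : L2 Ω (Fin 3 × Fin 3)))
        + (∫ t in Ioo 0 T', ramp (T' - δ) δ t * rampRemainder η γ V S (S T') t)
        - γ * I + D + 1 / 2 * ‖S₀‖ ^ 2)
  have hle : ∀ᶠ δ in 𝓝[>] 0, ((∫⁻ t in Ioo 0 T', P (S t) : ENNReal) : EReal) ≤ (r δ : EReal) := by
    filter_upwards [Ioo_mem_nhdsGT hT'] with δ hδ
    have ha : 0 ≤ T' - δ := by linarith [hδ.2]
    have h := (hvar _ _ (memZ_ramp hΩ hA ha hδ.1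
      (sub_add_cancel T' δ))).lintegral_potential_le_of_ramp hΩ hP hV hS hA ha hδ.1
        (sub_add_cancel T' δ)
    refine h.trans_eq ?_
    have e : ((ENNReal.ofReal δ * P (S T') : ENNReal) : EReal) =
        ((δ * (P (S T')).toReal : ℝ) : EReal) := by
      conv_lhs => rw [← ENNReal.ofReal_toReal hPA.ne]
      rw [← ENNReal.ofReal_mul hδ.1.le, EReal.coe_ennreal_ofReal,
        max_eq_left (mul_nonneg hδ.1.le ENNReal.toReal_nonneg)]
    rw [e, ← EReal.coe_add]
  have hlim : Tendsto r (𝓝[>] 0) (𝓝 (0 * (P (S T')).toReal + (1 / 2 * ‖S T'‖ ^ 2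
      - inner ℝ (S T' : L2 Ω (Fin 3 × Fin 3)) (S T' : L2 Ω (Fin 3 × Fin 3)) + 0
      - γ * I + D + 1 / 2 * ‖S₀‖ ^ 2))) := by
    have h0 : Tendsto (fun δ : ℝ => δ) (𝓝[>] 0) (𝓝 0) := tendsto_nhdsWithin_of_tendsto_nhds
      tendsto_id
    have h1 := tendsto_inv_smul_intervalIntegral_left hT' hSi hder
    have h2 := tendsto_setIntegral_ramp_mul (integrable_rampRemainder hΩ η γ hV hS hA)
    exact (h0.mul_const _).add (((((tendsto_const_nhds.sub
      (tendsto_const_nhds.inner h1)).add h2).sub_const _).add_const _).add_const _)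
  have hfinal := ge_of_tendsto ((continuous_coe_real_ereal.tendsto _).comp hlim) hle
  refine (add_le_add le_rfl hfinal).trans_eq ?_
  rw [← EReal.coe_add]
  congr 1
  rw [real_inner_self_eq_norm_sq, Submodule.coe_norm]
  ring

end Energy

/-- The interval is a countable union of the intervals `(0, q)` with `q` rational, also when `T` is
infinite. -/
theorem ae_restrict_timeInterval {T : EReal} {p : ℝ → Prop}
    (h : ∀ T' ∈ timeInterval T, ∀ᵐ t ∂(volume.restrict (Ioo 0 T')), p t) :
    ∀ᵐ t ∂(volume.restrict (timeInterval T)), p t := by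
  have hsub : timeInterval T ⊆ ⋃ q ∈ {q : ℚ | (q : ℝ) ∈ timeInterval T}, Ioo (0 : ℝ) q := by
    intro t ht
    obtain ⟨q, h1, h2⟩ := EReal.lt_iff_exists_rat_btwn.1 ht.2
    have h1' : t < (q : ℝ) := EReal.coe_lt_coe_iff.1 h1
    exact mem_iUnion₂.2 ⟨q, ⟨ht.1.trans h1', h2⟩, ht.1, h1'⟩
  refine ae_restrict_of_ae_restrict_of_subset hsub ?_
  rw [ae_restrict_biUnion_iff _ (to_countable _)]
  exact fun q hq => h _ hq

end ViscoFluid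

open ViscoFluid
theorem proposition3p1 (Ω : Set Vec) (hΩ : IsBoundedLipschitzDomain Ω)
    (T : EReal) (hT : 0 < T) (η μ γ : ℝ) (hη : 0 < η) (hμ : 0 < μ) (hγ : 0 < γ)
    (P : L2dev Ω → ENNReal) (hP : IsPotential P)
    (V₀ : L2 Ω (Fin 3)) (hV₀ : IsSolenoidal V₀) (S₀ : L2dev Ω)
    (F₀ : ℝ → L2 Ω (Fin 3))
    (hF₀ : ∀ T' ∈ timeInterval T, MemLp F₀ 1 (volume.restrict (Ioo 0 T')))
    (F₁ : ℝ → L2 Ω (Fin 3 × Fin 3))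
    (hF₁ : ∀ T' ∈ timeInterval T, MemLp F₁ 2 (volume.restrict (Ioo 0 T')))
    (g : ℝ → Lp Vec 2 (surfaceMeasure Ω))
    (V : ℝ → L2 Ω (Fin 3)) (S : ℝ → L2dev Ω)
    (hsol : IsGeneralizedSolution T η μ γ P V₀ S₀ F₀ F₁ g V S) :
    ∀ᵐ T' ∂(volume.restrict (timeInterval T)),
      ((1 / 2 * ‖S T'‖ ^ 2
          + γ * ∫ t in Ioo 0 T', ‖weakGrad (S t : L2 Ω (Fin 3 × Fin 3))‖ ^ 2 : ℝ) : EReal)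
        + ((∫⁻ t in Ioo 0 T', P (S t) : ENNReal) : EReal) ≤
      ((1 / 2 * ‖S₀‖ ^ 2
          + ∫ t in Ioo 0 T', ∫ x in Ω, η * inner ℝ (symPart (weakGrad (V t) x))
              ((S t : L2 Ω (Fin 3 × Fin 3)) x) : ℝ) : EReal) := by
  refine ae_restrict_timeInterval fun τ hτ => ?_
  have hX := hsol.memX τ hτ
  have hPfin := ae_potential_lt_top hP hX
    (lintegral_potential_ne_top hΩ hP hτ.1 (hsol.memLH τ hτ) hX (hsol.variational τ hτ))
  have hSi : IntervalIntegrable (fun t => (S t : L2 Ω (Fin 3 × Fin 3))) volume 0 τ := by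
    rw [intervalIntegrable_iff_integrableOn_Ioo_of_le hτ.1.le]
    exact hX.memLp_coe.integrable (by norm_num)
  -- The variational inequality holds for every final time, so a null set is lost only through the
  -- conditions on `S` at `T'`: `H¹` regularity, finite potential, and Lebesgue differentiation of
  -- the Bochner primitive.
  filter_upwards [hX.memL2H1.1, hPfin, ae_restrict_of_ae hSi.ae_hasDerivAt_integral,
    ae_restrict_mem measurableSet_Ioo] with T' hH1 hPT hder hT'
  have hmem : T' ∈ timeInterval T := ⟨hT'.1, (EReal.coe_lt_coe_iff.2 hT'.2).trans hτ.2⟩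
  rw [uIcc_of_le hτ.1.le] at hder
  exact energy_inequality_at hΩ hP hT'.1 (hsol.memLH T' hmem) (hsol.memX T' hmem)
    (hsol.variational T' hmem) hH1 hPT
    (hder ⟨hT'.1.le, hT'.2.le⟩ 0 (left_mem_Icc.2 hτ.1.le))
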